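/- Let $\mathbb S^2\subset\mathbb R^3$ be the unit sphere, and let $\fint $ denote the mean over $\mathbb S^2$ with respect to the surface measure. Let $W^{1,2}(\mathbb S^2;\mathbb R^3)$ be the Sobolev space with inner product $\fint \langle v,w\rangle+\fint \langle\nabla_Tv,\nabla_Tw\rangle$, where $\nabla_T$ is the (weak) tangential gradient, whose rows are the tangential gradients $\nabla_Tw^j$ of the components, and where matrices carry the Frobenius inner product. Put $$H_3=\Big\{w\in W^{1,2}(\mathbb S^2;\mathbb R^3):\ \fint w=0,\ \fint \langle w,x\rangle=0\Big\},\qquad A(w)=(\operatorname{div}_{\mathbb S^2}w)\,x-\sum_{j=1}^3x_j\nabla_Tw^j,$$ where $\operatorname{div}_{\mathbb S^2}w$ is the trace of $\nabla_T w$, and $$Q_3(v,w)=\tfrac34\fint \langle\nabla_Tv,\nabla_Tw\rangle-\tfrac32\fint \langle v,A(w)\rangle,\qquad Q_3(w)=Q_3(w,w).$$ For $k\ge1$ let $H_{3,k}$ be the space of all $w\in H_3$ each of whose components is a spherical harmonic of order $k$ (the restriction of a homogeneous harmonic polynomial of degree $k$), let $H_{3,k,\mathrm{sol}}$ be the space of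 those $w\in H_{3,k}$ whose componentwise harmonic extension to the unit ball is divergence free, let $H_{3,k,2}=\{w\in H_{3,k,\mathrm{sol}}:A(w)=w\}$, and let $H_{3,k,3}$ be the $W^{1,2}$-orthogonal complement of $H_{3,k,\mathrm{sol}}$ in $H_{3,k}$. Theorem. The spaces $H_{3,1,2}$ and $H_{3,2,3}$ are $W^{1,2}$-orthogonal, and their sum $H_{3,0}:=H_{3,1,2}\oplus H_{3,2,3}$ is the kernel of $Q_3$ in $H_3$, that is, $$H_{3,0}=\{w\in H_3: Q_3(v,w)=0\ \text{for all } v\in H_3\}=\{w\in H_3:Q_3(w)=0\}.$$ The $W^{1,2}$-orthogonal projection $\Pi_{3,0}$ onto $H_{3,0}$ exists, and for every $w\in H_3$ $$Q_3(w)\ \ge\ \frac14\fint \big|\nabla_Tw-\nabla_T(\Pi_{3,0}w)\big|^2 .$$ The constant $\frac14$ is sharp: if $C\in\mathbb R$ is such that $Q_3(w)\ge C\fint |\nabla_Tw-\nabla_T(\Pi_{3,0}w)|^2$ for every $w\in H_3$, then $C\le\frac14$. -/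

import Mathlib

open MeasureTheory

noncomputable section

namespace SphereCoercivity

/-- Euclidean three-space. -/
abbrev E3 : Type := EuclideanSpace ℝ (Fin 3)

/-- The unit sphere of Euclidean three-space. -/
abbrev S2 : Type := Metric.sphere (0 : E3) 1

/-- The normalized surface measure of the unit sphere: the rotation-invariant surface measure
divided by its total mass, so that `∫ x, f x ∂σ` is the mean value of `f` over the sphere. -/
def σ : Measure S2 :=
  ((volume : Measure E3).toSphere Set.univ)⁻¹ • (volume : Measure E3).toSphere

instance : IsProbabilityMeasure σ where
  measure_univ := by
    have h0 : (volume : Measure E3).toSphere Set.univ ≠ 0 := by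
      rw [Ne, Measure.measure_univ_eq_zero]
      exact Measure.toSphere_ne_zero _
    simp only [σ, Measure.smul_apply, smul_eq_mul]
    exact ENNReal.inv_mul_cancel h0 (measure_ne_top _ _)

/-- Values of the tangential gradient of an `E3`-valued map: the `j`-th row is the tangential
gradient of the `j`-th component, a vector of `E3` tangent to the sphere.
The norm is the Frobenius norm. -/
abbrev Grad3 : Type := PiLp 2 (fun _ : Fin 3 => E3)

/-- The divergence on the sphere of (the restriction of) an ambient smooth field `φ`, i.e. the
trace of `dφ` over the tangent plane, written as the full trace minus the normal part. -/
def divSmooth (φ : E3 → E3) (x : E3) : ℝ :=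
  ∑ i, (fderiv ℝ φ x (EuclideanSpace.single i 1)) i - inner ℝ x (fderiv ℝ φ x x)

/-- Smooth vector fields that are tangent to the sphere at its points. -/
def IsTangentTest (φ : E3 → E3) : Prop :=
  ContDiff ℝ (⊤ : ℕ∞) φ ∧ ∀ x : S2, inner ℝ (x : E3) (φ x) = 0

/-- `G` is the weak tangential gradient of `w`: its rows are tangent fields, and the `j`-th row
satisfies the integration by parts formula for the `j`-th component of `w` against every smooth
tangent field. -/
def IsWeakGrad (w : Lp E3 2 σ) (G : Lp Grad3 2 σ) : Prop :=
  (∀ᵐ x : S2 ∂σ, ∀ j, inner ℝ (x : E3) (G x j) = 0) ∧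
    ∀ j, ∀ φ : E3 → E3, IsTangentTest φ →
      ∫ x : S2, inner ℝ (G x j) (φ x) ∂σ = - ∫ x : S2, w x j * divSmooth φ x ∂σ

lemma continuous_divSmooth {φ : E3 → E3} (h : ContDiff ℝ (⊤ : ℕ∞) φ) :
    Continuous (divSmooth φ) := by
  have h1 : Continuous (fderiv ℝ φ) := h.continuous_fderiv (by simp)
  unfold divSmooth
  fun_prop

lemma memLp_of_continuous {F : Type*} [NormedAddCommGroup F] {ψ : S2 → F} (h : Continuous ψ) :
    MemLp ψ 2 σ :=
  h.memLp_of_hasCompactSupport (HasCompactSupport.of_compactSpace ψ)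

lemma memLp_comp (w : Lp E3 2 σ) (j : Fin 3) : MemLp (fun x => w x j) 2 σ :=
  (EuclideanSpace.proj (𝕜 := ℝ) (ι := Fin 3) j).comp_memLp' (Lp.memLp w)

lemma memLp_row (G : Lp Grad3 2 σ) (j : Fin 3) : MemLp (fun x => G x j) 2 σ :=
  (PiLp.proj (𝕜 := ℝ) 2 (fun _ : Fin 3 => E3) j).comp_memLp' (Lp.memLp G)

lemma integrable_inner_of_memLp {F : Type*} [NormedAddCommGroup F] [InnerProductSpace ℝ F]
    {f g : S2 → F} (hf : MemLp f 2 σ) (hg : MemLp g 2 σ) :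
    Integrable (fun x => inner ℝ (f x) (g x)) σ := by
  refine (hf.norm.integrable_mul hg.norm).mono (hf.1.inner hg.1) (.of_forall fun x => ?_)
  simpa using abs_real_inner_le_norm (f x) (g x)

lemma integrable_row (G : Lp Grad3 2 σ) (j : Fin 3) {φ : E3 → E3} (h : IsTangentTest φ) :
    Integrable (fun x : S2 => inner ℝ (G x j) (φ x)) σ :=
  integrable_inner_of_memLp (memLp_row G j)
    (memLp_of_continuous (h.1.continuous.comp continuous_subtype_val))

lemma integrable_comp (w : Lp E3 2 σ) (j : Fin 3) {φ : E3 → E3} (h : IsTangentTest φ) :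
    Integrable (fun x : S2 => w x j * divSmooth φ x) σ :=
  (memLp_comp w j).integrable_mul
    (memLp_of_continuous ((continuous_divSmooth h.1).comp continuous_subtype_val))

lemma IsWeakGrad.zero : IsWeakGrad 0 0 := by
  have hw := Lp.coeFn_zero E3 2 σ
  have hG := Lp.coeFn_zero Grad3 2 σ
  refine ⟨?_, fun j φ _ => ?_⟩
  · filter_upwards [hG] with x hx j
    simp [hx]
  · rw [integral_congr_ae (g := fun _ => (0 : ℝ)) (by filter_upwards [hG] with x hx; simp),
      integral_congr_ae (f := fun x : S2 => (0 : Lp E3 2 σ) x j * divSmooth φ x)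
        (g := fun _ => (0 : ℝ)) (by filter_upwards [hw] with x hx; simp)]
    simp

lemma IsWeakGrad.add {w w' : Lp E3 2 σ} {G G' : Lp Grad3 2 σ} (h : IsWeakGrad w G)
    (h' : IsWeakGrad w' G') : IsWeakGrad (w + w') (G + G') := by
  have hw := Lp.coeFn_add w w'
  have hG := Lp.coeFn_add G G'
  refine ⟨?_, fun j φ hφ => ?_⟩
  · filter_upwards [hG, h.1, h'.1] with x hx h1 h2 j
    rw [hx, Pi.add_apply, PiLp.add_apply, inner_add_right, h1 j, h2 j, add_zero]
  · have e1 : (fun x : S2 => inner ℝ ((G + G') x j) (φ x)) =ᵐ[σ]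
        fun x => inner ℝ (G x j) (φ x) + inner ℝ (G' x j) (φ x) := by
      filter_upwards [hG] with x hx
      rw [hx, Pi.add_apply, PiLp.add_apply, inner_add_left]
    have e2 : (fun x : S2 => (w + w') x j * divSmooth φ x) =ᵐ[σ]
        fun x => w x j * divSmooth φ x + w' x j * divSmooth φ x := by
      filter_upwards [hw] with x hx
      rw [hx, Pi.add_apply, PiLp.add_apply, add_mul]
    rw [integral_congr_ae e1, integral_congr_ae e2,
      integral_add (integrable_row G j hφ) (integrable_row G' j hφ),
      integral_add (integrable_comp w j hφ) (integrable_comp w' j hφ), h.2 j φ hφ, h'.2 j φ hφ]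
    ring

lemma IsWeakGrad.smul (c : ℝ) {w : Lp E3 2 σ} {G : Lp Grad3 2 σ} (h : IsWeakGrad w G) :
    IsWeakGrad (c • w) (c • G) := by
  have hw := Lp.coeFn_smul c w
  have hG := Lp.coeFn_smul c G
  refine ⟨?_, fun j φ hφ => ?_⟩
  · filter_upwards [hG, h.1] with x hx h1 j
    rw [hx, Pi.smul_apply, PiLp.smul_apply, inner_smul_right, h1 j, mul_zero]
  · have e1 : (fun x : S2 => inner ℝ ((c • G) x j) (φ x)) =ᵐ[σ]
        fun x => c * inner ℝ (G x j) (φ x) := by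
      filter_upwards [hG] with x hx
      rw [hx, Pi.smul_apply, PiLp.smul_apply, real_inner_smul_left]
    have e2 : (fun x : S2 => (c • w) x j * divSmooth φ x) =ᵐ[σ]
        fun x => c * (w x j * divSmooth φ x) := by
      filter_upwards [hw] with x hx
      rw [hx, Pi.smul_apply, PiLp.smul_apply, smul_eq_mul, mul_assoc]
    rw [integral_congr_ae e1, integral_congr_ae e2, integral_const_mul, integral_const_mul,
      h.2 j φ hφ]
    ring

/-- The Sobolev space of `E3`-valued maps on the sphere that are square integrable together with
their weak tangential gradient. A member is the pair of the map and its (unique) weak gradient;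
the ambient inner product is the Sobolev inner product: the mean of `⟨v, w⟩` plus the mean of
`⟨∇v, ∇w⟩`. -/
def W12 : Submodule ℝ (WithLp 2 (Lp E3 2 σ × Lp Grad3 2 σ)) where
  carrier := {u | IsWeakGrad u.fst u.snd}
  zero_mem' := IsWeakGrad.zero
  add_mem' := fun h h' => IsWeakGrad.add h h'
  smul_mem' := fun c _ h => IsWeakGrad.smul c h

/-- The underlying map of a Sobolev map. -/
def val (w : W12) : S2 → E3 := (w : WithLp 2 (Lp E3 2 σ × Lp Grad3 2 σ)).fst

/-- The tangential gradient of a Sobolev map. -/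
def grad (w : W12) : S2 → Grad3 := (w : WithLp 2 (Lp E3 2 σ × Lp Grad3 2 σ)).snd

lemma val_zero : val 0 =ᵐ[σ] 0 := Lp.coeFn_zero E3 2 σ

lemma grad_zero : grad 0 =ᵐ[σ] 0 := Lp.coeFn_zero Grad3 2 σ

lemma val_add (v w : W12) : val (v + w) =ᵐ[σ] val v + val w := Lp.coeFn_add _ _

lemma grad_add (v w : W12) : grad (v + w) =ᵐ[σ] grad v + grad w := Lp.coeFn_add _ _

lemma val_smul (c : ℝ) (w : W12) : val (c • w) =ᵐ[σ] c • val w := Lp.coeFn_smul c _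

lemma grad_smul (c : ℝ) (w : W12) : grad (c • w) =ᵐ[σ] c • grad w := Lp.coeFn_smul c _

lemma memLp_val (w : W12) : MemLp (val w) 2 σ := Lp.memLp _

lemma integrable_val (w : W12) : Integrable (val w) σ :=
  (memLp_val w).integrable (by norm_num)

lemma integrable_normal (w : W12) : Integrable (fun x : S2 => inner ℝ (val w x) (x : E3)) σ :=
  integrable_inner_of_memLp (memLp_val w) (memLp_of_continuous continuous_subtype_val)

/-- The space `H₃`: Sobolev maps `w` with vanishing mean and vanishing mean of `⟨w, x⟩`. -/
def H : Submodule ℝ W12 where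
  carrier := {w | ∫ x, val w x ∂σ = 0 ∧ ∫ x : S2, inner ℝ (val w x) (x : E3) ∂σ = 0}
  zero_mem' := by
    constructor
    · rw [integral_congr_ae val_zero]; simp
    · rw [integral_congr_ae (g := fun _ => (0 : ℝ))
        (by filter_upwards [val_zero] with x hx; simp [hx])]
      simp
  add_mem' := by
    intro v w hv hw
    constructor
    · rw [integral_congr_ae (val_add v w)]
      simp only [Pi.add_apply]
      rw [integral_add (integrable_val v) (integrable_val w), hv.1, hw.1, add_zero]
    · rw [integral_congr_ae (g := fun x : S2 => inner ℝ (val v x) (x : E3) +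
          inner ℝ (val w x) (x : E3))
        (by filter_upwards [val_add v w] with x hx; simp [hx, inner_add_left]),
        integral_add (integrable_normal v) (integrable_normal w), hv.2, hw.2, add_zero]
  smul_mem' := by
    intro c w hw
    constructor
    · rw [integral_congr_ae (val_smul c w)]
      simp only [Pi.smul_apply]
      rw [integral_smul, hw.1, smul_zero]
    · rw [integral_congr_ae (g := fun x : S2 => c * inner ℝ (val w x) (x : E3))
        (by filter_upwards [val_smul c w] with x hx; simp [hx, inner_smul_left]),
        integral_const_mul, hw.2, mul_zero]

/-- The components of `p` are homogeneous harmonic polynomials of degree `k`. -/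
def IsHomHarmonic (k : ℕ) (p : Fin 3 → MvPolynomial (Fin 3) ℝ) : Prop :=
  ∀ j, (p j).IsHomogeneous k ∧ ∑ i, MvPolynomial.pderiv i (MvPolynomial.pderiv i (p j)) = 0

/-- The map `w` is the restriction of `p` to the sphere. For `p` harmonic, this says that `p` is
the harmonic extension of `w` to the unit ball. -/
def IsRestriction (p : Fin 3 → MvPolynomial (Fin 3) ℝ) (w : W12) : Prop :=
  ∀ᵐ x : S2 ∂σ, ∀ j, val w x j = MvPolynomial.eval (fun i => (x : E3) i) (p j)

lemma IsHomHarmonic.zero (k : ℕ) : IsHomHarmonic k 0 := fun _ =>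
  ⟨MvPolynomial.isHomogeneous_zero _ _ _, by simp⟩

lemma IsHomHarmonic.add {k : ℕ} {p q : Fin 3 → MvPolynomial (Fin 3) ℝ}
    (hp : IsHomHarmonic k p) (hq : IsHomHarmonic k q) : IsHomHarmonic k (p + q) := fun j =>
  ⟨(hp j).1.add (hq j).1, by
    simp only [Pi.add_apply, map_add, Finset.sum_add_distrib, (hp j).2, (hq j).2, add_zero]⟩

lemma IsHomHarmonic.smul {k : ℕ} (c : ℝ) {p : Fin 3 → MvPolynomial (Fin 3) ℝ}
    (hp : IsHomHarmonic k p) : IsHomHarmonic k (c • p) := fun j =>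
  ⟨Submodule.smul_mem (MvPolynomial.homogeneousSubmodule (Fin 3) ℝ k) c (hp j).1, by
    simp only [Pi.smul_apply, Derivation.map_smul, ← Finset.smul_sum, (hp j).2, smul_zero]⟩

lemma IsRestriction.zero : IsRestriction 0 0 := by
  filter_upwards [val_zero] with x hx j
  simp [hx]

lemma IsRestriction.add {p q : Fin 3 → MvPolynomial (Fin 3) ℝ} {v w : W12}
    (hv : IsRestriction p v) (hw : IsRestriction q w) : IsRestriction (p + q) (v + w) := by
  filter_upwards [val_add v w, hv, hw] with x hx h1 h2 j
  simp [hx, h1 j, h2 j]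

lemma IsRestriction.smul (c : ℝ) {p : Fin 3 → MvPolynomial (Fin 3) ℝ} {w : W12}
    (hw : IsRestriction p w) : IsRestriction (c • p) (c • w) := by
  filter_upwards [val_smul c w, hw] with x hx h1 j
  simp [hx, h1 j]

/-- The space `H₃,ₖ` of maps in `H₃` all of whose components are spherical harmonics of
order `k`. -/
def Hk (k : ℕ) : Submodule ℝ W12 where
  carrier := {w | w ∈ H ∧ ∃ p, IsHomHarmonic k p ∧ IsRestriction p w}
  zero_mem' := ⟨H.zero_mem, 0, IsHomHarmonic.zero k, IsRestriction.zero⟩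
  add_mem' := by
    rintro v w ⟨hv, p, hp, hpv⟩ ⟨hw, q, hq, hqw⟩
    exact ⟨H.add_mem hv hw, p + q, hp.add hq, hpv.add hqw⟩
  smul_mem' := by
    rintro c w ⟨hw, p, hp, hpw⟩
    exact ⟨H.smul_mem c hw, c • p, hp.smul c, hpw.smul c⟩

/-- The space `H₃,ₖ,sol` of those maps in `H₃,ₖ` whose harmonic extension is divergence free. -/
def HkSol (k : ℕ) : Submodule ℝ W12 where
  carrier := {w | w ∈ H ∧ ∃ p, IsHomHarmonic k p ∧ IsRestriction p w ∧
    ∑ j, MvPolynomial.pderiv j (p j) = 0}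
  zero_mem' := ⟨H.zero_mem, 0, IsHomHarmonic.zero k, IsRestriction.zero, by simp⟩
  add_mem' := by
    rintro v w ⟨hv, p, hp, hpv, hdp⟩ ⟨hw, q, hq, hqw, hdq⟩
    refine ⟨H.add_mem hv hw, p + q, hp.add hq, hpv.add hqw, ?_⟩
    simp only [Pi.add_apply, map_add, Finset.sum_add_distrib, hdp, hdq, add_zero]
  smul_mem' := by
    rintro c w ⟨hw, p, hp, hpw, hdp⟩
    refine ⟨H.smul_mem c hw, c • p, hp.smul c, hpw.smul c, ?_⟩
    simp only [Pi.smul_apply, Derivation.map_smul, ← Finset.smul_sum, hdp, smul_zero]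

/-- The tangential divergence of a Sobolev map: the trace of its tangential gradient. -/
def divS (w : W12) (x : S2) : ℝ := ∑ j, grad w x j j

/-- The first order operator `A(w) = (div w) x - ∑ⱼ xⱼ ∇wʲ`, with tangential divergence and
gradients. -/
def A (w : W12) (x : S2) : E3 :=
  divS w x • (x : E3) - ∑ j, (x : E3) j • grad w x j

lemma A_zero : A 0 =ᵐ[σ] 0 := by
  filter_upwards [grad_zero] with x hx
  simp [A, divS, hx]

lemma A_add (v w : W12) : A (v + w) =ᵐ[σ] A v + A w := by
  filter_upwards [grad_add v w] with x hx
  simp only [A, divS, hx, Pi.add_apply, PiLp.add_apply, Finset.sum_add_distrib, add_smul, smul_add]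
  abel

lemma A_smul (c : ℝ) (w : W12) : A (c • w) =ᵐ[σ] c • A w := by
  filter_upwards [grad_smul c w] with x hx
  simp only [A, divS, hx, Pi.smul_apply, PiLp.smul_apply, smul_sub, Finset.smul_sum,
    ← Finset.mul_sum, smul_eq_mul, smul_smul]
  congr 1
  exact Finset.sum_congr rfl fun j _ => by rw [mul_comm]

/-- The space `H₃,ₖ,₂`: the eigenspace of `A` in `H₃,ₖ,sol` for the eigenvalue `1`. -/
def Hk2 (k : ℕ) : Submodule ℝ W12 where
  carrier := {w | w ∈ HkSol k ∧ A w =ᵐ[σ] val w}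
  zero_mem' := ⟨(HkSol k).zero_mem, A_zero.trans val_zero.symm⟩
  add_mem' := by
    rintro v w ⟨hv, hAv⟩ ⟨hw, hAw⟩
    exact ⟨(HkSol k).add_mem hv hw,
      (A_add v w).trans ((hAv.add hAw).trans (val_add v w).symm)⟩
  smul_mem' := by
    rintro c w ⟨hw, hAw⟩
    exact ⟨(HkSol k).smul_mem c hw,
      (A_smul c w).trans ((hAw.const_smul c).trans (val_smul c w).symm)⟩

/-- The space `H₃,ₖ,₃`: the orthogonal complement of `H₃,ₖ,sol` in `H₃,ₖ` for the Sobolev inner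
product. -/
def Hk3 (k : ℕ) : Submodule ℝ W12 := Hk k ⊓ (HkSol k)ᗮ

/-- The space `H₃,₀`, the sum of `H₃,₁,₂` and `H₃,₂,₃`. -/
def H0 : Submodule ℝ W12 := Hk2 1 ⊔ Hk3 2

/-- The bilinear form `Q₃(v, w)`. -/
def Q3bilin (v w : W12) : ℝ :=
  3 / 4 * ∫ x, inner ℝ (grad v x) (grad w x) ∂σ - 3 / 2 * ∫ x, inner ℝ (val v x) (A w x) ∂σ

/-- The quadratic form `Q₃(w)`. -/
def Q3 (w : W12) : ℝ :=
  3 / 4 * ∫ x, ‖grad w x‖ ^ 2 ∂σ - 3 / 2 * ∫ x, inner ℝ (val w x) (A w x) ∂σ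

end SphereCoercivity

end

/-! The form is diagonalised by spherical harmonics. On maps whose components are harmonic of order
k the Dirichlet form is k(k+1) times the mass (`dirichletForm_Harm`), and A is a first order
operator with explicit eigenfields (`exists_eigen_decomposition`): gradients of harmonic polynomials
of degree k+1, with eigenvalue -k; a second divergence-free family, with eigenvalue 1; and harmonic
projections of d·x with d harmonic of degree k-1, with eigenvalue k+1. Symmetry of A on polynomial
fields (`massForm_polyA_comm`) makes the families orthogonal.

On an eigenfield with eigenvalue μ the form Q₃ is therefore 3/4 k(k+1) - 3/2 μ times the mass. For k
≥ 1 this is negative only at k = 1, μ = 2, a mode spanned by the position field and excluded by the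
constraint on ⟨w, x⟩. It vanishes only at (k, μ) = (1, 1) and (2, 3), which are H₃,₁,₂ and H₃,₂,₃.
Elsewhere the ratio of Q₃ to the Dirichlet form is smallest for μ = k+1, where it is 3/4 (k-2)/k;
its least value for k ≥ 3 is 1/4, at k = 3. This gives both the constant and its sharpness.

To avoid approximating inside H₃, the estimate is proved on the whole Sobolev space with the penalty
2(mean of ⟨w, x⟩)², which lifts the negative mode and vanishes on H₃. The penalised difference of
the two sides is `gapForm`. It is nonnegative on finite sums of harmonics after subtracting a
suitable element of H₃,₀ (`exists_gapForm_nonneg`). The orthogonal projection can only lower the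
Dirichlet form further (`dirichletForm_sub_starProjection_le`), and density
(`iSup_Harm_topologicalClosure`) gives `coercivity`. A zero of Q₃ in H₃ then differs from its
projection by a map with zero gradient, hence by zero. -/

noncomputable section

namespace SphereCoercivity

/-! ### Rotation invariance and the divergence theorem on the sphere. -/

/-- A linear isometry acting on the unit sphere. -/
def sphereMap (R : E3 ≃ₗᵢ[ℝ] E3) (x : S2) : S2 := ⟨R x, by simp⟩

lemma continuous_sphereMap (R : E3 ≃ₗᵢ[ℝ] E3) : Continuous (sphereMap R) :=
  Continuous.subtype_mk (R.continuous.comp continuous_subtype_val) _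

-- The surface measure of a set is a multiple of the volume of the truncated cone over it. Linear
-- isometries preserve volume and commute with forming cones.
open scoped Pointwise in
lemma toSphere_preimage_sphereMap (R : E3 ≃ₗᵢ[ℝ] E3) {s : Set S2} (hs : MeasurableSet s) :
    (volume : Measure E3).toSphere (sphereMap R ⁻¹' s) = (volume : Measure E3).toSphere s := by
  rw [Measure.toSphere_apply' _ ((continuous_sphereMap R).measurable hs),
    Measure.toSphere_apply' _ hs]
  congr 1
  have hR : MeasurePreserving R.toMeasurableEquiv volume volume := R.measurePreserving
  rw [← hR.measure_preimage_equiv (Set.Ioo (0 : ℝ) 1 • (Subtype.val '' s))]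
  congr 1
  ext y
  simp only [Set.mem_smul, Set.mem_image, Set.mem_preimage]
  constructor
  · rintro ⟨r, hr, _, ⟨x, hx, rfl⟩, rfl⟩
    exact ⟨r, hr, R x, ⟨sphereMap R x, hx, rfl⟩, (map_smul R r (x : E3)).symm⟩
  · rintro ⟨r, hr, _, ⟨x, hx, rfl⟩, h⟩
    refine ⟨r, hr, R.symm x, ⟨sphereMap R.symm x, ?_, rfl⟩, ?_⟩
    · convert hx
      exact Subtype.ext (by simp [sphereMap])
    · have : R y = r • (x : E3) := h.symm
      rw [← map_smul, ← this, R.symm_apply_apply]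

lemma measurePreserving_sphereMap (R : E3 ≃ₗᵢ[ℝ] E3) : MeasurePreserving (sphereMap R) σ σ := by
  refine ⟨(continuous_sphereMap R).measurable, Measure.ext fun s hs => ?_⟩
  rw [Measure.map_apply (continuous_sphereMap R).measurable hs]
  simp only [σ, Measure.smul_apply, toSphere_preimage_sphereMap R hs]

lemma integral_sphereMap (R : E3 ≃ₗᵢ[ℝ] E3) {f : S2 → ℝ} (hf : Continuous f) :
    ∫ x, f (sphereMap R x) ∂σ = ∫ x, f x ∂σ := by
  have h := (measurePreserving_sphereMap R).map_eq
  conv_rhs => rw [← h]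
  rw [integral_map (continuous_sphereMap R).measurable.aemeasurable hf.aestronglyMeasurable]

/-- The velocity field of the rotations of the `(i, j)` plane. -/
def rotField (i j : Fin 3) : E3 →L[ℝ] E3 :=
  (EuclideanSpace.proj (𝕜 := ℝ) (ι := Fin 3) i).smulRight (EuclideanSpace.single j 1) -
    (EuclideanSpace.proj (𝕜 := ℝ) (ι := Fin 3) j).smulRight (EuclideanSpace.single i 1)

lemma rotField_apply (i j : Fin 3) (x : E3) :
    rotField i j x = x i • EuclideanSpace.single j 1 - x j • EuclideanSpace.single i 1 := rfl

/-- The rotation by the angle `t` in the `(i, j)` plane, as a linear map. -/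
def rotLin (i j : Fin 3) (t : ℝ) : E3 →L[ℝ] E3 :=
  ContinuousLinearMap.id ℝ E3 + Real.sin t • rotField i j +
    (1 - Real.cos t) • (rotField i j ∘L rotField i j)

lemma norm_rotLin {i j : Fin 3} (hij : i ≠ j) (t : ℝ) (x : E3) : ‖rotLin i j t x‖ = ‖x‖ := by
  have h := Real.sin_sq_add_cos_sq t
  rw [EuclideanSpace.norm_eq, EuclideanSpace.norm_eq]
  congr 1
  fin_cases i <;> fin_cases j <;> first | exact absurd rfl hij | skip
  all_goals
    simp [rotLin, rotField_apply, Fin.sum_univ_three, -Real.sin_sq_add_cos_sq]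
    ring_nf
    rw [Real.sin_sq]
    ring

/-- The rotation by the angle `t` in the `(i, j)` plane. -/
def rot {i j : Fin 3} (hij : i ≠ j) (t : ℝ) : E3 ≃ₗᵢ[ℝ] E3 :=
  LinearIsometry.toLinearIsometryEquiv ⟨(rotLin i j t).toLinearMap, norm_rotLin hij t⟩ rfl

/-- The generator K = `rotField i j` satisfies K³ = -K, so `rotLin` is Rodrigues' formula for
exp(tK), the flow of K. -/
lemma hasDerivAt_rotLin {i j : Fin 3} (hij : i ≠ j) (t : ℝ) (x : E3) :
    HasDerivAt (fun t => rotLin i j t x) (rotField i j (rotLin i j t x)) t := by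
  have h : HasDerivAt (fun t => x + Real.sin t • rotField i j x +
      (1 - Real.cos t) • rotField i j (rotField i j x))
      (Real.cos t • rotField i j x + Real.sin t • rotField i j (rotField i j x)) t := by
    have h1 := ((Real.hasDerivAt_sin t).smul_const (rotField i j x)).const_add x
    have h2 := ((Real.hasDerivAt_cos t).const_sub 1).smul_const (rotField i j (rotField i j x))
    exact (h1.add h2).congr_deriv (by rw [neg_neg])
  have h3 : rotField i j (rotField i j (rotField i j x)) = - rotField i j x := by
    ext l
    fin_cases i <;> fin_cases j <;> first | exact absurd rfl hij | skip
    all_goals fin_cases l <;> simp [rotField_apply]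
  have e : rotField i j (rotLin i j t x) =
      Real.cos t • rotField i j x + Real.sin t • rotField i j (rotField i j x) := by
    change rotField i j (x + Real.sin t • rotField i j x +
      (1 - Real.cos t) • rotField i j (rotField i j x)) = _
    rw [map_add, map_add, map_smul, map_smul, h3]
    module
  rw [e]
  exact h

/-- The infinitesimal rotation of the `(i, j)` plane applied to a smooth function integrates to
zero over the sphere. -/
lemma integral_fderiv_rotField {i j : Fin 3} (hij : i ≠ j) {f : E3 → ℝ} (hf : ContDiff ℝ 1 f) :
    ∫ x : S2, fderiv ℝ f x (rotField i j x) ∂σ = 0 := by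
  have hc : Continuous fun x : E3 => fderiv ℝ f x (rotField i j x) :=
    (hf.continuous_fderiv (by simp)).clm_apply (rotField i j).continuous
  obtain ⟨C, hC⟩ : ∃ C, ∀ x : S2, ‖fderiv ℝ f x (rotField i j x)‖ ≤ C := by
    obtain ⟨C, hC⟩ := (isCompact_sphere (0 : E3) 1).exists_bound_of_continuousOn hc.continuousOn
    exact ⟨C, fun x => hC x x.2⟩
  have hcont : ∀ t, Continuous fun x : S2 => f (rotLin i j t x) := fun t =>
    hf.continuous.comp ((rotLin i j t).continuous.comp continuous_subtype_val)
  have key := hasDerivAt_integral_of_dominated_loc_of_deriv_le (μ := σ) (𝕜 := ℝ)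
    (F := fun t (x : S2) => f (rotLin i j t x))
    (F' := fun t (x : S2) => fderiv ℝ f (rotLin i j t x) (rotField i j (rotLin i j t x)))
    (x₀ := 0) (s := Set.univ) (bound := fun _ => C) Filter.univ_mem
    (.of_forall fun t => (hcont t).aestronglyMeasurable)
    ((memLp_of_continuous (hcont 0)).integrable (by norm_num))
    (hc.comp ((rotLin i j 0).continuous.comp continuous_subtype_val)).aestronglyMeasurable
    (.of_forall fun x t _ => hC (sphereMap (rot hij t) x))
    (integrable_const C)
    (.of_forall fun x t _ =>
      ((hf.differentiable (by simp) _).hasFDerivAt).comp_hasDerivAt t (hasDerivAt_rotLin hij t x))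
  have h0 := key.2
  -- By rotation invariance the integral does not depend on t, so its derivative at t = 0, the
  -- integral in question, is zero.
  have hconst : (fun t => ∫ x : S2, f (rotLin i j t x) ∂σ) = fun _ => ∫ x : S2, f x ∂σ := by
    funext t
    exact integral_sphereMap (rot hij t) (f := fun x : S2 => f x)
      (hf.continuous.comp continuous_subtype_val)
  rw [hconst] at h0
  simpa [rotLin] using h0.unique (hasDerivAt_const _ _)

lemma sum_sq_coord (x : S2) : ∑ i, (x : E3) i ^ 2 = 1 := by
  have h : ‖(x : E3)‖ = 1 := by simp
  rw [EuclideanSpace.norm_eq, Real.sqrt_eq_one] at h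
  simpa using h

lemma e3_eq_sum (v : E3) : v = ∑ i, v i • EuclideanSpace.single i (1 : ℝ) := by
  ext l
  fin_cases l <;> simp [Fin.sum_univ_three]

lemma hasFDerivAt_coord {ψ : E3 → E3} {x : E3} (hψ : DifferentiableAt ℝ ψ x) (j : Fin 3) :
    HasFDerivAt (fun y => ψ y j) ((EuclideanSpace.proj (𝕜 := ℝ) (ι := Fin 3) j) ∘L fderiv ℝ ψ x)
      x :=
  ((EuclideanSpace.proj (𝕜 := ℝ) (ι := Fin 3) j).hasFDerivAt).comp x hψ.hasFDerivAt

lemma contDiff_coord {n : WithTop ℕ∞} {ψ : E3 → E3} (hψ : ContDiff ℝ n ψ) (j : Fin 3) :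
    ContDiff ℝ n (fun y => ψ y j) :=
  (EuclideanSpace.proj (𝕜 := ℝ) (ι := Fin 3) j).contDiff.comp hψ

/-- The `(i, j)` component of the exterior product of the position and the field `ψ`. -/
def wedge (ψ : E3 → E3) (i j : Fin 3) (x : E3) : ℝ := x i * ψ x j - x j * ψ x i

lemma contDiff_wedge {ψ : E3 → E3} (hψ : ContDiff ℝ 1 ψ) (i j : Fin 3) :
    ContDiff ℝ 1 (wedge ψ i j) :=
  ((contDiff_coord contDiff_id i).mul (contDiff_coord hψ j)).sub
    ((contDiff_coord contDiff_id j).mul (contDiff_coord hψ i))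

lemma fderiv_wedge {ψ : E3 → E3} {x : E3} (hψ : DifferentiableAt ℝ ψ x) (i j : Fin 3) (v : E3) :
    fderiv ℝ (wedge ψ i j) x v =
      v i * ψ x j + x i * fderiv ℝ ψ x v j - (v j * ψ x i + x j * fderiv ℝ ψ x v i) := by
  have h := ((hasFDerivAt_coord differentiableAt_id i).mul (hasFDerivAt_coord hψ j)).sub
    ((hasFDerivAt_coord differentiableAt_id j).mul (hasFDerivAt_coord hψ i))
  have h' : HasFDerivAt (wedge ψ i j) _ x := h
  rw [h'.fderiv]
  simp
  ring

lemma fderiv_eq_sum (ψ : E3 → E3) (x v : E3) (i : Fin 3) :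
    fderiv ℝ ψ x v i = ∑ l, v l * fderiv ℝ ψ x (EuclideanSpace.single l 1) i := by
  conv_lhs => rw [e3_eq_sum v]
  simp

lemma inner_e3 (v w : E3) : inner ℝ v w = ∑ i, v i * w i := by
  simp [PiLp.inner_apply, mul_comm]

/-- Expanding the rotational derivatives of x_i ψ_j - x_j ψ_i gives the divergence up to multiples
of ⟨x, ψ⟩ and |x|² - 1. No derivative of ⟨x, ψ⟩ enters, so tangency on the sphere itself suffices.
-/
lemma divSmooth_eq_sum_wedge {ψ : E3 → E3} (hψ : IsTangentTest ψ) (x : S2) :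
    divSmooth ψ x = fderiv ℝ (wedge ψ 0 1) x (rotField 0 1 x) +
      fderiv ℝ (wedge ψ 0 2) x (rotField 0 2 x) + fderiv ℝ (wedge ψ 1 2) x (rotField 1 2 x) := by
  have hd : DifferentiableAt ℝ ψ x := hψ.1.differentiable (by simp) _
  have ht := hψ.2 x
  have hx := sum_sq_coord x
  simp only [fderiv_wedge hd, rotField_apply, map_sub, map_smul, divSmooth]
  rw [inner_e3] at *
  simp only [fderiv_eq_sum ψ x x]
  simp only [Fin.sum_univ_three, PiLp.sub_apply, PiLp.smul_apply, PiLp.single_apply] at *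
  generalize fderiv ℝ ψ (x : E3) = D at *
  simp
  generalize (x : E3) 0 = a at *
  generalize (x : E3) 1 = b at *
  generalize (x : E3) 2 = c at *
  linear_combination (2 : ℝ) * ht + (-(D (EuclideanSpace.single 0 1) 0) -
    D (EuclideanSpace.single 1 1) 1 - D (EuclideanSpace.single 2 1) 2) * hx

/-- The divergence theorem on the sphere. -/
lemma integral_divSmooth {ψ : E3 → E3} (hψ : IsTangentTest ψ) :
    ∫ x : S2, divSmooth ψ x ∂σ = 0 := by
  have h1 : ContDiff ℝ 1 ψ := hψ.1.of_le (by exact_mod_cast le_top)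
  have hi : ∀ i j, Integrable (fun x : S2 => fderiv ℝ (wedge ψ i j) x (rotField i j x)) σ := by
    intro i j
    refine (memLp_of_continuous ?_).integrable (q := 2) (by norm_num)
    exact (((contDiff_wedge h1 i j).continuous_fderiv (by simp)).clm_apply
      (rotField i j).continuous).comp continuous_subtype_val
  simp only [divSmooth_eq_sum_wedge hψ]
  rw [integral_add ((hi 0 1).fun_add (hi 0 2)) (hi 1 2), integral_add (hi 0 1) (hi 0 2),
    integral_fderiv_rotField (by decide) (contDiff_wedge h1 0 1),
    integral_fderiv_rotField (by decide) (contDiff_wedge h1 0 2),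
    integral_fderiv_rotField (by decide) (contDiff_wedge h1 1 2)]
  simp

lemma IsTangentTest.smul {f : E3 → ℝ} {φ : E3 → E3} (hf : ContDiff ℝ (⊤ : ℕ∞) f)
    (hφ : IsTangentTest φ) : IsTangentTest (fun x => f x • φ x) :=
  ⟨hf.smul hφ.1, fun x => by rw [inner_smul_right, hφ.2 x, mul_zero]⟩

lemma divSmooth_smul {f : E3 → ℝ} {φ : E3 → E3} (hf : ContDiff ℝ (⊤ : ℕ∞) f)
    (hφ : IsTangentTest φ) (x : S2) :
    divSmooth (fun x => f x • φ x) x = f x * divSmooth φ x + fderiv ℝ f x (φ x) := by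
  have h := ((hf.differentiable (by simp) x).hasFDerivAt).smul
    ((hφ.1.differentiable (by simp) x).hasFDerivAt)
  have h' : HasFDerivAt (fun x => f x • φ x) _ (x : E3) := h
  have ht := hφ.2 x
  have e : fderiv ℝ f x (φ x) = ∑ l, φ x l * fderiv ℝ f x (EuclideanSpace.single l 1) := by
    conv_lhs => rw [e3_eq_sum (φ x)]
    simp only [map_sum, map_smul, smul_eq_mul]
  rw [divSmooth, h'.fderiv, divSmooth, e]
  simp [inner_add_right, inner_smul_right, ht, Finset.sum_add_distrib, ← Finset.mul_sum]
  simp only [Fin.sum_univ_three]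
  ring

/-- Integration by parts on the sphere. -/
lemma integral_mul_divSmooth {f : E3 → ℝ} {φ : E3 → E3} (hf : ContDiff ℝ (⊤ : ℕ∞) f)
    (hφ : IsTangentTest φ) :
    ∫ x : S2, fderiv ℝ f x (φ x) ∂σ = - ∫ x : S2, f x * divSmooth φ x ∂σ := by
  have h := integral_divSmooth (hφ.smul hf)
  simp only [divSmooth_smul hf hφ] at h
  have i1 : Integrable (fun x : S2 => f x * divSmooth φ x) σ :=
    (memLp_of_continuous ((hf.continuous.mul (continuous_divSmooth hφ.1)).comp
      continuous_subtype_val)).integrable (q := 2) (by norm_num)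
  have i2 : Integrable (fun x : S2 => fderiv ℝ f x (φ x)) σ :=
    (memLp_of_continuous (((hf.continuous_fderiv (by simp)).clm_apply
      hφ.1.continuous).comp continuous_subtype_val)).integrable (q := 2) (by norm_num)
  rw [integral_add i1 i2] at h
  linarith

/-! ### Tangential calculus of polynomials. -/

/-- The value of a polynomial at a point of Euclidean space. -/
def peval (p : MvPolynomial (Fin 3) ℝ) (x : E3) : ℝ := MvPolynomial.eval (fun i => x i) p

lemma peval_add (p q : MvPolynomial (Fin 3) ℝ) (x : E3) :
    peval (p + q) x = peval p x + peval q x := by simp [peval]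

lemma peval_sub (p q : MvPolynomial (Fin 3) ℝ) (x : E3) :
    peval (p - q) x = peval p x - peval q x := by simp [peval]

lemma peval_mul (p q : MvPolynomial (Fin 3) ℝ) (x : E3) :
    peval (p * q) x = peval p x * peval q x := by simp [peval]

lemma peval_smul (c : ℝ) (p : MvPolynomial (Fin 3) ℝ) (x : E3) :
    peval (c • p) x = c * peval p x := by simp [peval]

lemma peval_sum {ι : Type*} (s : Finset ι) (p : ι → MvPolynomial (Fin 3) ℝ) (x : E3) :
    peval (∑ i ∈ s, p i) x = ∑ i ∈ s, peval (p i) x := by simp [peval]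

lemma peval_X (i : Fin 3) (x : E3) : peval (MvPolynomial.X i) x = x i := by simp [peval]

lemma peval_C (c : ℝ) (x : E3) : peval (MvPolynomial.C c) x = c := by simp [peval]

lemma peval_zero (x : E3) : peval 0 x = 0 := by simp [peval]

lemma peval_one (x : E3) : peval 1 x = 1 := by simp [peval]

lemma contDiff_peval (p : MvPolynomial (Fin 3) ℝ) : ContDiff ℝ (⊤ : ℕ∞) (peval p) := by
  induction p using MvPolynomial.induction_on with
  | C a => simpa only [funext (peval_C a)] using contDiff_const
  | add p q hp hq => simpa only [funext (peval_add p q)] using hp.add hq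
  | mul_X p i hp =>
    have h := hp.mul (contDiff_coord contDiff_id i)
    rwa [show (fun y => peval p y * (id y : E3) i) = peval (p * MvPolynomial.X i) from
      funext fun y => by simp [peval_mul, peval_X]] at h

lemma continuous_peval (p : MvPolynomial (Fin 3) ℝ) : Continuous (peval p) :=
  (contDiff_peval p).continuous

lemma hasFDerivAt_peval (p : MvPolynomial (Fin 3) ℝ) (x : E3) :
    HasFDerivAt (peval p)
      (∑ i, peval (MvPolynomial.pderiv i p) x • EuclideanSpace.proj (𝕜 := ℝ) (ι := Fin 3) i) x := by
  induction p using MvPolynomial.induction_on with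
  | C a => simpa [funext (peval_C a), peval_zero] using hasFDerivAt_const a x
  | add p q hp hq =>
    rw [show peval (p + q) = peval p + peval q from funext (peval_add p q)]
    refine (hp.add hq).congr_fderiv ?_
    simp only [map_add, peval_add, add_smul, Finset.sum_add_distrib]
  | mul_X p i hp =>
    rw [show peval (p * MvPolynomial.X i) = peval p * fun y : E3 => y i from
      funext fun y => by simp [peval_mul, peval_X]]
    refine (hp.mul (EuclideanSpace.proj (𝕜 := ℝ) (ι := Fin 3) i).hasFDerivAt).congr_fderiv ?_
    ext v
    simp only [MvPolynomial.pderiv_mul, peval_add, peval_mul, peval_X, MvPolynomial.pderiv_X]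
    fin_cases i <;> simp [Fin.sum_univ_three, peval_zero, peval_one] <;> ring

lemma fderiv_peval (p : MvPolynomial (Fin 3) ℝ) (x v : E3) :
    fderiv ℝ (peval p) x v = ∑ i, peval (MvPolynomial.pderiv i p) x * v i := by
  rw [(hasFDerivAt_peval p x).fderiv]
  simp

/-- The vector field with polynomial components `p`. -/
def pfield (p : Fin 3 → MvPolynomial (Fin 3) ℝ) (x : E3) : E3 :=
  WithLp.toLp 2 fun i => peval (p i) x

lemma pfield_apply (p : Fin 3 → MvPolynomial (Fin 3) ℝ) (x : E3) (i : Fin 3) :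
    pfield p x i = peval (p i) x := rfl

lemma pfield_add (p q : Fin 3 → MvPolynomial (Fin 3) ℝ) (x : E3) :
    pfield (p + q) x = pfield p x + pfield q x := by
  ext i; simp [pfield_apply, peval_add]

lemma pfield_smul (c : ℝ) (p : Fin 3 → MvPolynomial (Fin 3) ℝ) (x : E3) :
    pfield (c • p) x = c • pfield p x := by
  ext i; simp [pfield_apply, peval_smul]

lemma contDiff_pfield (p : Fin 3 → MvPolynomial (Fin 3) ℝ) :
    ContDiff ℝ (⊤ : ℕ∞) (pfield p) :=
  (contDiff_piLp _).2 fun i => contDiff_peval (p i)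

lemma continuous_pfield (p : Fin 3 → MvPolynomial (Fin 3) ℝ) : Continuous (pfield p) :=
  (contDiff_pfield p).continuous

lemma fderiv_pfield (p : Fin 3 → MvPolynomial (Fin 3) ℝ) (x v : E3) (j : Fin 3) :
    fderiv ℝ (pfield p) x v j = ∑ i, peval (MvPolynomial.pderiv i (p j)) x * v i := by
  have h := hasFDerivAt_coord ((contDiff_pfield p).differentiable (by simp) x) j
  have h' : HasFDerivAt (peval (p j)) _ x := h
  rw [← fderiv_peval, h'.fderiv]
  rfl

/-- The Euler operator on polynomials. -/
def euler (p : MvPolynomial (Fin 3) ℝ) : MvPolynomial (Fin 3) ℝ :=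
  ∑ i, MvPolynomial.X i * MvPolynomial.pderiv i p

/-- The Laplace operator on polynomials. -/
def lap (p : MvPolynomial (Fin 3) ℝ) : MvPolynomial (Fin 3) ℝ :=
  ∑ i, MvPolynomial.pderiv i (MvPolynomial.pderiv i p)

/-- The tangential gradient of a polynomial, extended polynomially. -/
def tgrad (p : MvPolynomial (Fin 3) ℝ) (i : Fin 3) : MvPolynomial (Fin 3) ℝ :=
  MvPolynomial.pderiv i p - MvPolynomial.X i * euler p

lemma pderiv_comm (i j : Fin 3) (p : MvPolynomial (Fin 3) ℝ) :
    MvPolynomial.pderiv i (MvPolynomial.pderiv j p) =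
      MvPolynomial.pderiv j (MvPolynomial.pderiv i p) := by
  have h : ⁅MvPolynomial.pderiv (R := ℝ) i, MvPolynomial.pderiv (R := ℝ) j⁆ = 0 := by
    refine MvPolynomial.derivation_ext fun l => ?_
    rw [Derivation.commutator_apply]
    classical
    simp only [MvPolynomial.pderiv_X, Pi.single_apply]
    split_ifs <;> simp
  have h2 := congrArg (fun D => D p) h
  simpa [Derivation.commutator_apply, sub_eq_zero] using h2

lemma isTangentTest_tgrad (p : MvPolynomial (Fin 3) ℝ) : IsTangentTest (pfield (tgrad p)) := by
  refine ⟨contDiff_pfield _, fun x => ?_⟩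
  have hx := sum_sq_coord x
  rw [inner_e3]
  simp only [pfield_apply, tgrad, euler, Fin.sum_univ_three, peval_sub, peval_add, peval_mul,
    peval_X] at *
  linear_combination (-((x : E3) 0 * peval (MvPolynomial.pderiv 0 p) x +
    (x : E3) 1 * peval (MvPolynomial.pderiv 1 p) x +
    (x : E3) 2 * peval (MvPolynomial.pderiv 2 p) x)) * hx

/-- With E the Euler operator, the Laplace–Beltrami operator on restrictions is Δ - E - E². On a
harmonic polynomial of degree k it is multiplication by -k(k+1). -/
lemma divSmooth_tgrad (p : MvPolynomial (Fin 3) ℝ) (x : S2) :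
    divSmooth (pfield (tgrad p)) x = peval (lap p - euler p - euler (euler p)) x := by
  have hx := sum_sq_coord x
  rw [divSmooth, inner_e3]
  simp only [fderiv_pfield, tgrad, euler, lap, map_sub, map_add, MvPolynomial.pderiv_mul,
    MvPolynomial.pderiv_X,
    Fin.sum_univ_three, PiLp.single_apply, pderiv_comm 1 0, pderiv_comm 2 0, pderiv_comm 2 1] at *
  simp [peval_sub, peval_add, peval_mul, peval_X]
  generalize peval ((MvPolynomial.pderiv 0) p) ↑x = d0
  generalize peval ((MvPolynomial.pderiv 1) p) ↑x = d1
  generalize peval ((MvPolynomial.pderiv 2) p) ↑x = d2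
  generalize peval ((MvPolynomial.pderiv 0) ((MvPolynomial.pderiv 0) p)) ↑x = d00
  generalize peval ((MvPolynomial.pderiv 0) ((MvPolynomial.pderiv 1) p)) ↑x = d01
  generalize peval ((MvPolynomial.pderiv 0) ((MvPolynomial.pderiv 2) p)) ↑x = d02
  generalize peval ((MvPolynomial.pderiv 1) ((MvPolynomial.pderiv 1) p)) ↑x = d11
  generalize peval ((MvPolynomial.pderiv 1) ((MvPolynomial.pderiv 2) p)) ↑x = d12
  generalize peval ((MvPolynomial.pderiv 2) ((MvPolynomial.pderiv 2) p)) ↑x = d22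
  generalize (x : E3) 0 = a at *
  generalize (x : E3) 1 = b at *
  generalize (x : E3) 2 = c at *
  linear_combination (2 * (a * d0 + b * d1 + c * d2) +
    (a * a * d00 + b * b * d11 + c * c * d22 + 2 * a * b * d01 + 2 * a * c * d02 + 2 * b * c * d12)) * hx

/-! ### Polynomial fields as Sobolev maps. -/

/-- The class in `L²` of a continuous map on the sphere. -/
def contLp {F : Type*} [NormedAddCommGroup F] (f : S2 → F) (hf : Continuous f) : Lp F 2 σ :=
  (memLp_of_continuous hf).toLp f

lemma coeFn_contLp {F : Type*} [NormedAddCommGroup F] (f : S2 → F) (hf : Continuous f) :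
    contLp f hf =ᵐ[σ] f := MemLp.coeFn_toLp _

/-- The tangential gradient of the field with polynomial components `p`. -/
def pgrad (p : Fin 3 → MvPolynomial (Fin 3) ℝ) (x : E3) : Grad3 :=
  WithLp.toLp 2 fun j => pfield (tgrad (p j)) x

lemma pgrad_apply (p : Fin 3 → MvPolynomial (Fin 3) ℝ) (x : E3) (j : Fin 3) :
    pgrad p x j = pfield (tgrad (p j)) x := rfl

lemma continuous_pgrad (p : Fin 3 → MvPolynomial (Fin 3) ℝ) : Continuous (pgrad p) :=
  (PiLp.continuous_toLp 2 _).comp (continuous_pi fun _ => continuous_pfield _)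

lemma continuous_pfield_sphere (p : Fin 3 → MvPolynomial (Fin 3) ℝ) :
    Continuous fun x : S2 => pfield p x :=
  (continuous_pfield p).comp continuous_subtype_val

lemma continuous_pgrad_sphere (p : Fin 3 → MvPolynomial (Fin 3) ℝ) :
    Continuous fun x : S2 => pgrad p x :=
  (continuous_pgrad p).comp continuous_subtype_val

lemma tgrad_add (p q : MvPolynomial (Fin 3) ℝ) : tgrad (p + q) = tgrad p + tgrad q := by
  funext i
  simp only [tgrad, euler, map_add, Pi.add_apply, mul_add, Finset.sum_add_distrib]
  ring

lemma tgrad_smul (c : ℝ) (p : MvPolynomial (Fin 3) ℝ) : tgrad (c • p) = c • tgrad p := by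
  funext i
  simp only [tgrad, euler, Derivation.map_smul, Pi.smul_apply, mul_smul_comm, ← Finset.smul_sum,
    smul_sub]

lemma inner_tgrad (p : MvPolynomial (Fin 3) ℝ) {φ : E3 → E3} (hφ : IsTangentTest φ) (x : S2) :
    inner ℝ (pfield (tgrad p) x) (φ x) = fderiv ℝ (peval p) x (φ x) := by
  have ht := hφ.2 x
  rw [inner_e3] at *
  rw [fderiv_peval]
  simp only [pfield_apply, tgrad, peval_sub, peval_mul, peval_X, Fin.sum_univ_three] at *
  linear_combination -(peval (euler p) x) * ht

lemma isWeakGrad_poly (p : Fin 3 → MvPolynomial (Fin 3) ℝ) :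
    IsWeakGrad (contLp _ (continuous_pfield_sphere p))
      (contLp _ (continuous_pgrad_sphere p)) := by
  have h1 := coeFn_contLp _ (continuous_pfield_sphere p)
  have h2 := coeFn_contLp _ (continuous_pgrad_sphere p)
  refine ⟨?_, fun j φ hφ => ?_⟩
  · filter_upwards [h2] with x hx j
    rw [hx, pgrad_apply]
    exact (isTangentTest_tgrad (p j)).2 x
  · have e := integral_mul_divSmooth (contDiff_peval (p j)) hφ
    rw [integral_congr_ae (g := fun x : S2 => fderiv ℝ (peval (p j)) x (φ x)), e]
    · congr 1
      refine integral_congr_ae ?_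
      filter_upwards [h1] with x hx
      rw [hx]
      rfl
    · filter_upwards [h2] with x hx
      rw [hx, pgrad_apply, inner_tgrad _ hφ]

lemma W12.ext {v w : W12} (h1 : val v =ᵐ[σ] val w) (h2 : grad v =ᵐ[σ] grad w) : v = w := by
  refine Subtype.ext (WithLp.ofLp_injective 2 (Prod.ext (Lp.ext h1) (Lp.ext h2)))

/-- The Sobolev map with polynomial components `p`. -/
def polyMap : (Fin 3 → MvPolynomial (Fin 3) ℝ) →ₗ[ℝ] W12 where
  toFun p := ⟨WithLp.toLp 2 (contLp _ (continuous_pfield_sphere p),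
    contLp _ (continuous_pgrad_sphere p)), isWeakGrad_poly p⟩
  map_add' p q := by
    refine W12.ext ?_ ?_
    · refine .trans ?_ (val_add _ _).symm
      refine (coeFn_contLp _ (continuous_pfield_sphere (p + q))).trans ?_
      filter_upwards [coeFn_contLp _ (continuous_pfield_sphere p),
        coeFn_contLp _ (continuous_pfield_sphere q)] with x h1 h2
      exact (pfield_add p q x).trans (congrArg₂ (· + ·) h1.symm h2.symm)
    · refine .trans ?_ (grad_add _ _).symm
      refine (coeFn_contLp _ (continuous_pgrad_sphere (p + q))).trans ?_
      filter_upwards [coeFn_contLp _ (continuous_pgrad_sphere p),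
        coeFn_contLp _ (continuous_pgrad_sphere q)] with x h1 h2
      refine .trans ?_ (congrArg₂ (· + ·) h1.symm h2.symm)
      ext j i
      simp [pgrad_apply, tgrad_add, pfield_add]
  map_smul' c p := by
    refine W12.ext ?_ ?_
    · refine .trans ?_ (val_smul _ _).symm
      refine (coeFn_contLp _ (continuous_pfield_sphere (c • p))).trans ?_
      filter_upwards [coeFn_contLp _ (continuous_pfield_sphere p)] with x h1
      exact (pfield_smul c p x).trans (congrArg (c • ·) h1.symm)
    · refine .trans ?_ (grad_smul _ _).symm
      refine (coeFn_contLp _ (continuous_pgrad_sphere (c • p))).trans ?_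
      filter_upwards [coeFn_contLp _ (continuous_pgrad_sphere p)] with x h1
      refine .trans ?_ (congrArg (c • ·) h1.symm)
      ext j i
      simp [pgrad_apply, tgrad_smul, pfield_smul]

lemma val_polyMap (p : Fin 3 → MvPolynomial (Fin 3) ℝ) :
    val (polyMap p) =ᵐ[σ] fun x => pfield p x :=
  coeFn_contLp _ (continuous_pfield_sphere p)

lemma grad_polyMap (p : Fin 3 → MvPolynomial (Fin 3) ℝ) :
    grad (polyMap p) =ᵐ[σ] fun x => pgrad p x :=
  coeFn_contLp _ (continuous_pgrad_sphere p)

attribute [irreducible] polyMap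

/-! ### Density of polynomials, uniqueness of weak gradients, completeness. -/

/-- Restriction of polynomials to the sphere, as continuous functions. -/
def polyC : MvPolynomial (Fin 3) ℝ →ₐ[ℝ] C(S2, ℝ) :=
  MvPolynomial.aeval fun i => ⟨fun x : S2 => (x : E3) i, by fun_prop⟩

lemma polyC_apply (p : MvPolynomial (Fin 3) ℝ) (x : S2) : polyC p x = peval p x := by
  induction p using MvPolynomial.induction_on with
  | C a => simp [polyC, peval_C]
  | add p q hp hq => simp [map_add, hp, hq, peval_add]
  | mul_X p i hp =>
    rw [map_mul, ContinuousMap.mul_apply, hp, peval_mul, peval_X]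
    simp [polyC]

lemma polyC_range_closure : polyC.range.topologicalClosure = ⊤ := by
  refine ContinuousMap.subalgebra_topologicalClosure_eq_top_of_separatesPoints _ ?_
  intro x y hxy
  have : ∃ i, (x : E3) i ≠ (y : E3) i := by
    by_contra! h
    exact hxy (Subtype.ext (PiLp.ext h))
  obtain ⟨i, hi⟩ := this
  refine ⟨fun x => peval (MvPolynomial.X i) x, ⟨polyC (MvPolynomial.X i), ⟨_, rfl⟩, ?_⟩, ?_⟩
  · funext z
    exact polyC_apply _ z
  · simpa [peval_X] using hi

instance : CompactSpace S2 := isCompact_iff_compactSpace.1 (isCompact_sphere 0 1)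

/-- A square integrable function orthogonal to all polynomials vanishes. -/
lemma ae_eq_zero_of_integral_peval {g : S2 → ℝ} (hg : MemLp g 2 σ)
    (h : ∀ p, ∫ x : S2, g x * peval p x ∂σ = 0) : g =ᵐ[σ] 0 := by
  set G := hg.toLp g with hG
  have hp : ∀ p : MvPolynomial (Fin 3) ℝ,
      inner ℝ (ContinuousMap.toLp 2 σ ℝ (polyC p)) G = 0 := by
    intro p
    rw [L2.inner_def, ← h p]
    refine integral_congr_ae ?_
    filter_upwards [hg.coeFn_toLp, ContinuousMap.coeFn_toLp (p := 2) (𝕜 := ℝ) σ (polyC p)]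
      with x h1 h2
    rw [h1, h2, polyC_apply]
    simp
  -- Stone–Weierstrass extends orthogonality to all continuous functions; their density in L² then
  -- allows testing against G itself.
  have hc : ∀ f : C(S2, ℝ), inner ℝ (ContinuousMap.toLp 2 σ ℝ f) G = 0 := by
    intro f
    have hf : f ∈ closure (polyC.range : Set C(S2, ℝ)) := by
      rw [← Subalgebra.topologicalClosure_coe, polyC_range_closure]
      trivial
    refine closure_minimal (t := {f | inner ℝ (ContinuousMap.toLp 2 σ ℝ f) G = 0}) ?_ ?_ hf
    · rintro _ ⟨p, rfl⟩
      exact hp p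
    · exact isClosed_eq (by fun_prop) continuous_const
  have hz : inner ℝ G G = (0 : ℝ) := by
    refine (ContinuousMap.toLp_denseRange ℝ σ ℝ (p := 2) (by norm_num)).induction_on
      (p := fun F : Lp ℝ 2 σ => inner ℝ F G = 0) G ?_ hc
    exact isClosed_eq (by fun_prop) continuous_const
  have hz' : G = 0 := inner_self_eq_zero.1 hz
  refine hg.coeFn_toLp.symm.trans ?_
  rw [← hG, hz']
  exact Lp.coeFn_zero _ _ _

lemma memLp_entry (G : Lp Grad3 2 σ) (j i : Fin 3) : MemLp (fun x => G x j i) 2 σ :=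
  (EuclideanSpace.proj (𝕜 := ℝ) (ι := Fin 3) i).comp_memLp' (memLp_row G j)

/-- The tangential projection of the `i`-th coordinate field, times `f`. -/
def tangentCoord (f : MvPolynomial (Fin 3) ℝ) (i l : Fin 3) : MvPolynomial (Fin 3) ℝ :=
  f * ((if l = i then 1 else 0) - MvPolynomial.X i * MvPolynomial.X l)

lemma isTangentTest_tangentCoord (f : MvPolynomial (Fin 3) ℝ) (i : Fin 3) :
    IsTangentTest (pfield (tangentCoord f i)) := by
  refine ⟨contDiff_pfield _, fun x => ?_⟩
  have hx := sum_sq_coord x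
  rw [inner_e3]
  fin_cases i <;>
  simp [pfield_apply, tangentCoord, peval_sub, peval_mul, peval_X, peval_one, peval_zero,
    Fin.sum_univ_three] at *
  · linear_combination (-peval f x * (x : E3) 0) * hx
  · linear_combination (-peval f x * (x : E3) 1) * hx
  · linear_combination (-peval f x * (x : E3) 2) * hx

/-- The weak tangential gradient is unique. -/
lemma eq_zero_of_val {w : W12} (h : val w =ᵐ[σ] 0) : w = 0 := by
  refine W12.ext (h.trans val_zero.symm) (.trans ?_ grad_zero.symm)
  have key : ∀ j i, (fun x => grad w x j i) =ᵐ[σ] 0 := by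
    intro j i
    refine ae_eq_zero_of_integral_peval (memLp_entry _ j i) fun f => ?_
    -- Because the row is tangent, pairing it with f (e_i - x_i x) returns f times its i-th entry.
    have h2 := w.2.2 j _ (isTangentTest_tangentCoord f i)
    have h3 : ∫ x : S2, (w : WithLp 2 (Lp E3 2 σ × Lp Grad3 2 σ)).fst x j *
        divSmooth (pfield (tangentCoord f i)) x ∂σ = 0 := by
      rw [integral_congr_ae (g := fun _ => (0 : ℝ))]
      · simp
      · filter_upwards [h] with x hx
        have hx' : (w : WithLp 2 (Lp E3 2 σ × Lp Grad3 2 σ)).fst x = 0 := hx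
        simp [hx']
    rw [h3, neg_zero] at h2
    rw [← h2]
    refine integral_congr_ae ?_
    filter_upwards [w.2.1] with x hx
    have hx := hx j
    rw [inner_e3] at *
    change grad w x j i * _ = ∑ l, grad w x j l * _
    change ∑ l, (x : E3) l * grad w x j l = 0 at hx
    fin_cases i <;>
    simp [pfield_apply, tangentCoord, peval_sub, peval_mul, peval_X, peval_one, peval_zero,
      Fin.sum_univ_three] at *
    · linear_combination (peval f x * (x : E3) 0) * hx
    · linear_combination (peval f x * (x : E3) 1) * hx
    · linear_combination (peval f x * (x : E3) 2) * hx
  have hall : ∀ᵐ x ∂σ, ∀ j i, grad w x j i = 0 := by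
    rw [ae_all_iff]
    intro j
    rw [ae_all_iff]
    exact key j
  filter_upwards [hall] with x hx
  ext j i
  exact hx j i

lemma eq_of_val {v w : W12} (h : val v =ᵐ[σ] val w) : v = w := by
  rw [← sub_eq_zero]
  refine eq_zero_of_val ?_
  rw [sub_eq_add_neg, ← neg_one_smul ℝ w]
  filter_upwards [val_add v ((-1 : ℝ) • w), val_smul (-1) w, h] with x h1 h2 h3
  rw [h1, Pi.add_apply, h2, Pi.smul_apply, h3]
  simp

/-- The matrix field whose `j`-th row is `φ` and whose other rows vanish. -/
def rowField (j : Fin 3) (φ : E3 → E3) (x : S2) : Grad3 := PiLp.single 2 j (φ x)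

lemma continuous_rowField (j : Fin 3) {φ : E3 → E3} (h : Continuous φ) :
    Continuous (rowField j φ) := by
  refine (PiLp.continuous_toLp 2 _).comp (continuous_pi fun l => ?_)
  rcases eq_or_ne l j with rfl | hl
  · simpa [Function.comp_def] using h.comp continuous_subtype_val
  · simpa [hl] using continuous_const

/-- The vector field whose `j`-th component is `f` and whose other components vanish. -/
def compField (j : Fin 3) (f : E3 → ℝ) (x : S2) : E3 := EuclideanSpace.single j (f x)

lemma continuous_compField (j : Fin 3) {f : E3 → ℝ} (h : Continuous f) :
    Continuous (compField j f) := by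
  refine (PiLp.continuous_toLp 2 _).comp (continuous_pi fun l => ?_)
  rcases eq_or_ne l j with rfl | hl
  · simpa [Function.comp_def] using h.comp continuous_subtype_val
  · simpa [hl] using continuous_const

lemma inner_rowField (G : Lp Grad3 2 σ) (j : Fin 3) {φ : E3 → E3} (h : Continuous φ) :
    inner ℝ G (contLp _ (continuous_rowField j h)) = ∫ x : S2, inner ℝ (G x j) (φ x) ∂σ := by
  rw [L2.inner_def]
  refine integral_congr_ae ?_
  filter_upwards [coeFn_contLp _ (continuous_rowField j h)] with x hx
  rw [hx, rowField, PiLp.inner_apply]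
  fin_cases j <;> simp [Fin.sum_univ_three]

lemma inner_compField (w : Lp E3 2 σ) (j : Fin 3) {f : E3 → ℝ} (h : Continuous f) :
    inner ℝ w (contLp _ (continuous_compField j h)) = ∫ x : S2, w x j * f x ∂σ := by
  rw [L2.inner_def]
  refine integral_congr_ae ?_
  filter_upwards [coeFn_contLp _ (continuous_compField j h)] with x hx
  rw [hx, compField, inner_e3]
  fin_cases j <;> simp

/-- This trades a pointwise almost everywhere condition for L² pairings, which are stable under L²
limits. -/
lemma ae_tangent_iff (G : Lp Grad3 2 σ) :
    (∀ᵐ x : S2 ∂σ, ∀ j, inner ℝ (x : E3) (G x j) = 0) ↔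
      ∀ j f, ∫ x : S2, inner ℝ (G x j) (peval f x • (x : E3)) ∂σ = 0 := by
  constructor
  · intro h j f
    rw [integral_congr_ae (g := fun _ => (0 : ℝ))]
    · simp
    · filter_upwards [h] with x hx
      rw [inner_smul_right, real_inner_comm, hx j, mul_zero]
  · intro h
    rw [ae_all_iff]
    intro j
    have hm : MemLp (fun x : S2 => inner ℝ (x : E3) (G x j)) 2 σ := by
      refine ((memLp_row G j).norm).mono
        (continuous_subtype_val.aestronglyMeasurable.inner (memLp_row G j).1) (.of_forall fun x => ?_)
      have h1 : ‖(x : E3)‖ = 1 := by simp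
      simpa [h1] using abs_real_inner_le_norm (x : E3) (G x j)
    refine ae_eq_zero_of_integral_peval hm fun f => ?_
    rw [← h j f]
    refine integral_congr_ae (.of_forall fun x => ?_)
    simp only [inner_smul_right, real_inner_comm]
    ring

/-- Both defining conditions are equations between inner products with fixed L² elements. The
resulting completeness is what turns a trivial orthogonal complement into density of the harmonics.
-/
lemma isClosed_W12 : IsClosed (W12 : Set (WithLp 2 (Lp E3 2 σ × Lp Grad3 2 σ))) := by
  have e : (W12 : Set (WithLp 2 (Lp E3 2 σ × Lp Grad3 2 σ))) =
      {u | ∀ j f, inner ℝ u.snd (contLp _ (continuous_rowField j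
        ((continuous_peval f).smul continuous_id))) = 0} ∩
      {u | ∀ j φ, ∀ h : IsTangentTest φ,
        inner ℝ u.snd (contLp _ (continuous_rowField j h.1.continuous)) =
        - inner ℝ u.fst (contLp _ (continuous_compField j (continuous_divSmooth h.1)))} := by
    ext u
    refine and_congr ((ae_tangent_iff _).trans ?_) ?_
    · refine forall_congr' fun j => forall_congr' fun f => ?_
      rw [inner_rowField _ j ((continuous_peval f).smul continuous_id)]
      rfl
    · refine forall_congr' fun j => forall_congr' fun φ => forall_congr' fun h => ?_
      rw [inner_rowField _ j h.1.continuous, inner_compField _ j (continuous_divSmooth h.1)]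
  rw [e]
  simp only [Set.ofPred_forall]
  refine IsClosed.inter ?_ ?_
  · refine isClosed_iInter fun j => isClosed_iInter fun f => isClosed_eq ?_ continuous_const
    exact (WithLp.prod_continuous_ofLp 2 _ _).snd.inner continuous_const
  · refine isClosed_iInter fun j => isClosed_iInter fun φ => isClosed_iInter fun h =>
      isClosed_eq ?_ ?_
    · exact (WithLp.prod_continuous_ofLp 2 _ _).snd.inner continuous_const
    · exact ((WithLp.prod_continuous_ofLp 2 _ _).fst.inner continuous_const).neg

instance : CompleteSpace W12 := isClosed_W12.completeSpace_coe

/-! ### Eigenfields of A among harmonic polynomial fields. -/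

open MvPolynomial (X pderiv)

/-- The operator `A` on polynomial fields. -/
def polyA (p : Fin 3 → MvPolynomial (Fin 3) ℝ) (i : Fin 3) : MvPolynomial (Fin 3) ℝ :=
  ∑ j, (X i * pderiv j (p j) - X j * pderiv i (p j))

/-- The divergence of a polynomial field. -/
def pdiv (p : Fin 3 → MvPolynomial (Fin 3) ℝ) : MvPolynomial (Fin 3) ℝ := ∑ j, pderiv j (p j)

/-- The inner product of the position with a polynomial field. -/
def xdot (p : Fin 3 → MvPolynomial (Fin 3) ℝ) : MvPolynomial (Fin 3) ℝ := ∑ j, X j * p j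

/-- The gradient of a polynomial. -/
def polyGrad (f : MvPolynomial (Fin 3) ℝ) (i : Fin 3) : MvPolynomial (Fin 3) ℝ := pderiv i f

/-- The square of the Euclidean norm, as a polynomial. -/
def rsq : MvPolynomial (Fin 3) ℝ := ∑ j, X j ^ 2

lemma pderiv_X_ite (i j : Fin 3) :
    pderiv i (X j : MvPolynomial (Fin 3) ℝ) = if j = i then 1 else 0 := by
  rw [MvPolynomial.pderiv_X, Pi.single_apply]

lemma pderiv_rsq (i : Fin 3) : pderiv i rsq = (2 : ℝ) • X i := by
  rw [MvPolynomial.smul_eq_C_mul]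
  simp only [rsq, map_sum, MvPolynomial.pderiv_pow, pderiv_X_ite]
  fin_cases i <;> simp [(map_ofNat MvPolynomial.C 2).symm]

lemma lap_add (f g : MvPolynomial (Fin 3) ℝ) : lap (f + g) = lap f + lap g := by
  simp [lap, Finset.sum_add_distrib]

lemma lap_sub (f g : MvPolynomial (Fin 3) ℝ) : lap (f - g) = lap f - lap g := by
  simp [lap, Finset.sum_sub_distrib]

lemma lap_smul (c : ℝ) (f : MvPolynomial (Fin 3) ℝ) : lap (c • f) = c • lap f := by
  simp [lap, Finset.smul_sum]

lemma lap_sum {ι : Type*} (s : Finset ι) (f : ι → MvPolynomial (Fin 3) ℝ) :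
    lap (∑ i ∈ s, f i) = ∑ i ∈ s, lap (f i) := by
  simp only [lap, map_sum]
  rw [Finset.sum_comm]

lemma lap_pderiv (i : Fin 3) (f : MvPolynomial (Fin 3) ℝ) :
    lap (pderiv i f) = pderiv i (lap f) := by
  simp only [lap, map_sum]
  exact Finset.sum_congr rfl fun j _ => by rw [pderiv_comm j i f, pderiv_comm j i]

lemma lap_X_mul (i : Fin 3) (f : MvPolynomial (Fin 3) ℝ) :
    lap (X i * f) = (2 : ℝ) • pderiv i f + X i * lap f := by
  rw [MvPolynomial.smul_eq_C_mul]
  simp only [lap, MvPolynomial.pderiv_mul, map_add, pderiv_X_ite, Fin.sum_univ_three]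
  have h2 : (MvPolynomial.C (2 : ℝ) : MvPolynomial (Fin 3) ℝ) = 2 := rfl
  rw [h2]
  fin_cases i <;> simp <;> ring

lemma lap_rsq_mul (f : MvPolynomial (Fin 3) ℝ) :
    lap (rsq * f) = (6 : ℝ) • f + (4 : ℝ) • euler f + rsq * lap f := by
  have h (i : Fin 3) : pderiv i (pderiv i (rsq * f)) =
      (2 : ℝ) • f + (4 : ℝ) • (X i * pderiv i f) + rsq * pderiv i (pderiv i f) := by
    simp only [MvPolynomial.pderiv_mul, map_add, pderiv_rsq, Derivation.map_smul,
      MvPolynomial.pderiv_X_self, smul_mul_assoc, one_mul, smul_add]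
    module
  simp only [lap, h, Finset.sum_add_distrib, ← Finset.smul_sum, euler, ← Finset.mul_sum]
  simp only [Finset.sum_const, Finset.card_univ, Fintype.card_fin]
  rw [← lap]
  module

/-- The polynomial `f` is homogeneous of degree `k` and harmonic. -/
def IsHarm (k : ℕ) (f : MvPolynomial (Fin 3) ℝ) : Prop := f.IsHomogeneous k ∧ lap f = 0

lemma euler_of_isHomogeneous {k : ℕ} {f : MvPolynomial (Fin 3) ℝ} (h : f.IsHomogeneous k) :
    euler f = (k : ℝ) • f := by
  rw [euler, h.sum_X_mul_pderiv, Nat.cast_smul_eq_nsmul]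

lemma pderiv_of_isHomogeneous_zero {f : MvPolynomial (Fin 3) ℝ} (h : f.IsHomogeneous 0)
    (i : Fin 3) : pderiv i f = 0 := by
  rw [← MvPolynomial.totalDegree_zero_iff_isHomogeneous,
    MvPolynomial.totalDegree_eq_zero_iff_eq_C] at h
  rw [h, MvPolynomial.pderiv_C]

lemma IsHarm.zero (k : ℕ) : IsHarm k 0 :=
  ⟨MvPolynomial.isHomogeneous_zero _ _ _, by simp [lap]⟩

lemma IsHarm.add {k : ℕ} {f g : MvPolynomial (Fin 3) ℝ} (hf : IsHarm k f) (hg : IsHarm k g) :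
    IsHarm k (f + g) := ⟨hf.1.add hg.1, by rw [lap_add, hf.2, hg.2, add_zero]⟩

lemma IsHarm.sub {k : ℕ} {f g : MvPolynomial (Fin 3) ℝ} (hf : IsHarm k f) (hg : IsHarm k g) :
    IsHarm k (f - g) := ⟨hf.1.sub hg.1, by rw [lap_sub, hf.2, hg.2, sub_zero]⟩

lemma isHomogeneous_smul {k : ℕ} (c : ℝ) {f : MvPolynomial (Fin 3) ℝ} (hf : f.IsHomogeneous k) :
    (c • f).IsHomogeneous k :=
  Submodule.smul_mem (MvPolynomial.homogeneousSubmodule (Fin 3) ℝ k) c hf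

lemma IsHarm.smul {k : ℕ} (c : ℝ) {f : MvPolynomial (Fin 3) ℝ} (hf : IsHarm k f) :
    IsHarm k (c • f) := ⟨isHomogeneous_smul c hf.1, by rw [lap_smul, hf.2, smul_zero]⟩

lemma IsHarm.sum {k : ℕ} {ι : Type*} (s : Finset ι) {f : ι → MvPolynomial (Fin 3) ℝ}
    (hf : ∀ i ∈ s, IsHarm k (f i)) : IsHarm k (∑ i ∈ s, f i) :=
  ⟨MvPolynomial.IsHomogeneous.sum _ _ _ fun i hi => (hf i hi).1,
    by rw [lap_sum, Finset.sum_eq_zero fun i hi => (hf i hi).2]⟩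

lemma IsHarm.pderiv {k : ℕ} {f : MvPolynomial (Fin 3) ℝ} (hf : IsHarm (k + 1) f) (i : Fin 3) :
    IsHarm k (pderiv i f) := ⟨hf.1.pderiv, by rw [lap_pderiv, hf.2, map_zero]⟩

lemma IsHarm.pdiv {k : ℕ} {p : Fin 3 → MvPolynomial (Fin 3) ℝ} (hp : ∀ j, IsHarm (k + 1) (p j)) :
    IsHarm k (pdiv p) := IsHarm.sum _ fun j _ => (hp j).pderiv j

lemma lap_xdot {k : ℕ} {p : Fin 3 → MvPolynomial (Fin 3) ℝ} (hp : ∀ j, IsHarm k (p j)) :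
    lap (xdot p) = (2 : ℝ) • pdiv p := by
  simp only [xdot, lap_sum, lap_X_mul, (hp _).2, mul_zero, add_zero, pdiv, Finset.smul_sum]

/-- Since Δ(x·p) = 2 div p for harmonic components, solenoidal fields have a harmonic normal part.
-/
lemma isHarm_xdot {k : ℕ} {p : Fin 3 → MvPolynomial (Fin 3) ℝ} (hp : ∀ j, IsHarm k (p j))
    (hd : pdiv p = 0) : IsHarm (k + 1) (xdot p) := by
  refine ⟨MvPolynomial.IsHomogeneous.sum _ _ _ fun j _ => ?_, by rw [lap_xdot hp, hd, smul_zero]⟩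
  rw [add_comm]
  exact (MvPolynomial.isHomogeneous_X _ _).mul (hp j).1

/-- The form A p = x div p - ∇(x·p) + p reduces the eigenvalue computations to the two scalars div p
and x·p. -/
lemma polyA_eq (p : Fin 3 → MvPolynomial (Fin 3) ℝ) (i : Fin 3) :
    polyA p i = X i * pdiv p - pderiv i (xdot p) + p i := by
  simp only [polyA, pdiv, xdot, map_sum, MvPolynomial.pderiv_mul, pderiv_X_ite]
  fin_cases i <;> simp [Fin.sum_univ_three] <;> ring

lemma polyA_add (p q : Fin 3 → MvPolynomial (Fin 3) ℝ) : polyA (p + q) = polyA p + polyA q := by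
  funext i
  simp only [polyA, Pi.add_apply, map_add, mul_add, ← Finset.sum_add_distrib]
  exact Finset.sum_congr rfl fun j _ => by ring

lemma polyA_smul (c : ℝ) (p : Fin 3 → MvPolynomial (Fin 3) ℝ) : polyA (c • p) = c • polyA p := by
  funext i
  simp only [polyA, Pi.smul_apply, Derivation.map_smul, mul_smul_comm, ← smul_sub, Finset.smul_sum]

lemma polyA_sub (p q : Fin 3 → MvPolynomial (Fin 3) ℝ) : polyA (p - q) = polyA p - polyA q := by
  rw [sub_eq_add_neg, ← neg_one_smul ℝ q, polyA_add, polyA_smul]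
  module

lemma pdiv_add (p q : Fin 3 → MvPolynomial (Fin 3) ℝ) : pdiv (p + q) = pdiv p + pdiv q := by
  simp [pdiv, Finset.sum_add_distrib]

lemma pdiv_sub (p q : Fin 3 → MvPolynomial (Fin 3) ℝ) : pdiv (p - q) = pdiv p - pdiv q := by
  simp [pdiv]

lemma pdiv_smul (c : ℝ) (p : Fin 3 → MvPolynomial (Fin 3) ℝ) : pdiv (c • p) = c • pdiv p := by
  simp [pdiv, Finset.smul_sum]

lemma pdiv_polyGrad (f : MvPolynomial (Fin 3) ℝ) : pdiv (polyGrad f) = lap f := rfl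

lemma xdot_polyGrad (f : MvPolynomial (Fin 3) ℝ) : xdot (polyGrad f) = euler f := rfl

/-- Here div ∇f = 0 and x·∇f = (k+1) f, so A∇f = ∇f - (k+1)∇f. -/
lemma polyA_polyGrad {k : ℕ} {f : MvPolynomial (Fin 3) ℝ} (hf : IsHarm (k + 1) f) :
    polyA (polyGrad f) = (-k : ℝ) • polyGrad f := by
  funext i
  rw [polyA_eq, pdiv_polyGrad, xdot_polyGrad, hf.2, euler_of_isHomogeneous hf.1,
    Derivation.map_smul]
  simp only [Pi.smul_apply, polyGrad, mul_zero]
  push_cast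
  module

/-- The harmonic field obtained from a harmonic polynomial `d` of degree `m` by projecting
`d • x` to the fields with harmonic components. -/
def radialHarm (m : ℕ) (d : MvPolynomial (Fin 3) ℝ) (i : Fin 3) : MvPolynomial (Fin 3) ℝ :=
  X i * d - (2 * m + 1 : ℝ)⁻¹ • (rsq * pderiv i d)

lemma isHomogeneous_rsq : rsq.IsHomogeneous 2 :=
  MvPolynomial.IsHomogeneous.sum _ _ _ fun i _ => MvPolynomial.isHomogeneous_X_pow i 2

/-- The coefficient 1/(2m+1) balances Δ(x_i d) = 2 ∂_i d against Δ(|x|² ∂_i d) = (6 + 4(m-1)) ∂_i d.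
Degree m = 0 is separate because ∂_i d then vanishes and has no degree m-1. -/
lemma isHarm_radialHarm {m : ℕ} {d : MvPolynomial (Fin 3) ℝ} (hd : IsHarm m d) (i : Fin 3) :
    IsHarm (m + 1) (radialHarm m d i) := by
  rcases m with _ | m
  · simp only [radialHarm, pderiv_of_isHomogeneous_zero hd.1, mul_zero, smul_zero, sub_zero]
    refine ⟨?_, ?_⟩
    · exact add_comm 0 1 ▸ (MvPolynomial.isHomogeneous_X _ _).mul hd.1
    · rw [lap_X_mul, hd.2, pderiv_of_isHomogeneous_zero hd.1]
      simp
  · have h1 := hd.pderiv i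
    refine ⟨?_, ?_⟩
    · refine MvPolynomial.IsHomogeneous.sub ?_ (isHomogeneous_smul _ ?_)
      · exact add_comm 1 (m + 1) ▸ (MvPolynomial.isHomogeneous_X _ _).mul hd.1
      · have := isHomogeneous_rsq.mul h1.1
        convert this using 1
        ring
    · rw [radialHarm, lap_sub, lap_smul, lap_X_mul, lap_rsq_mul, hd.2, h1.2,
        euler_of_isHomogeneous h1.1, mul_zero, mul_zero, add_zero, add_zero, smul_smul, ← add_smul,
        smul_smul, ← sub_smul]
      have : (2 * ((m + 1 : ℕ) : ℝ) + 1) ≠ 0 := by positivity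
      rw [show (2 : ℝ) - (2 * ((m + 1 : ℕ) : ℝ) + 1)⁻¹ * (6 + 4 * m) = 0 by
        field_simp; push_cast; ring, zero_smul]

lemma pdiv_radialHarm {m : ℕ} {d : MvPolynomial (Fin 3) ℝ} (hd : IsHarm m d) :
    pdiv (radialHarm m d) = ((m + 1) * (2 * m + 3) / (2 * m + 1) : ℝ) • d := by
  have h (i : Fin 3) : pderiv i (radialHarm m d i) = d + X i * pderiv i d -
      (2 * m + 1 : ℝ)⁻¹ • ((2 : ℝ) • (X i * pderiv i d) + rsq * pderiv i (pderiv i d)) := by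
    simp only [radialHarm, map_sub, MvPolynomial.pderiv_mul, Derivation.map_smul, pderiv_rsq,
      MvPolynomial.pderiv_X_self, one_mul, smul_mul_assoc]
  have e : ∑ i, X i * pderiv i d = (m : ℝ) • d := euler_of_isHomogeneous hd.1
  have e2 : ∑ i, pderiv i (pderiv i d) = 0 := hd.2
  simp only [pdiv, h, Finset.sum_sub_distrib, Finset.sum_add_distrib, ← Finset.smul_sum,
    ← Finset.mul_sum, e, e2]
  have : (2 * (m : ℝ) + 1) ≠ 0 := by positivity
  simp only [Finset.sum_const, Finset.card_univ, Fintype.card_fin, mul_zero, add_zero]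
  match_scalars
  field_simp
  ring

lemma xdot_radialHarm {m : ℕ} {d : MvPolynomial (Fin 3) ℝ} (hd : IsHarm m d) :
    xdot (radialHarm m d) = ((m + 1) / (2 * m + 1) : ℝ) • (rsq * d) := by
  have h (i : Fin 3) : X i * radialHarm m d i =
      X i ^ 2 * d - (2 * m + 1 : ℝ)⁻¹ • (rsq * (X i * pderiv i d)) := by
    rw [radialHarm, mul_sub, mul_smul_comm]
    congr 1
    · ring
    · congr 1
      ring
  have e : ∑ i, X i * pderiv i d = (m : ℝ) • d := euler_of_isHomogeneous hd.1
  simp only [xdot, h, Finset.sum_sub_distrib, ← Finset.smul_sum, ← Finset.mul_sum,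
    ← Finset.sum_mul, e]
  rw [← rsq, mul_smul_comm]
  have : (2 * (m : ℝ) + 1) ≠ 0 := by positivity
  match_scalars
  field_simp
  ring

/-- The coefficient of x_i d in A is (m+1)(2m+3)/(2m+1) - 2(m+1)/(2m+1) + 1 = m+2, from the
divergence, the normal part and the identity respectively. -/
lemma polyA_radialHarm {m : ℕ} {d : MvPolynomial (Fin 3) ℝ} (hd : IsHarm m d) :
    polyA (radialHarm m d) = (m + 2 : ℝ) • radialHarm m d := by
  funext i
  rw [polyA_eq, pdiv_radialHarm hd, xdot_radialHarm hd, Derivation.map_smul,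
    MvPolynomial.pderiv_mul, pderiv_rsq]
  simp only [Pi.smul_apply, radialHarm, mul_smul_comm, smul_mul_assoc]
  have : (2 * (m : ℝ) + 1) ≠ 0 := by positivity
  match_scalars <;> field_simp <;> ring

/-- Every field with homogeneous harmonic components of degree `m + 1` is a sum of eigenfields of
`A` for the eigenvalues `-(m + 1)`, `1` and `m + 2`; the first two are divergence free. -/
lemma exists_eigen_decomposition {m : ℕ} {p : Fin 3 → MvPolynomial (Fin 3) ℝ}
    (hp : ∀ j, IsHarm (m + 1) (p j)) :
    ∃ a b c : Fin 3 → MvPolynomial (Fin 3) ℝ, p = a + b + c ∧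
      (∀ j, IsHarm (m + 1) (a j)) ∧ (∀ j, IsHarm (m + 1) (b j)) ∧ (∀ j, IsHarm (m + 1) (c j)) ∧
      pdiv a = 0 ∧ pdiv b = 0 ∧
      polyA a = (-(m + 1) : ℝ) • a ∧ polyA b = b ∧ polyA c = (m + 2 : ℝ) • c ∧
      (∃ d, ∃ t : ℝ, IsHarm m d ∧ c = t • radialHarm m d) ∧ (pdiv p = 0 → c = 0) := by
  have hd := IsHarm.pdiv hp
  have hm : (2 * (m : ℝ) + 1) ≠ 0 := by positivity
  -- This is the inverse of the factor in `pdiv_radialHarm`, so that subtracting c removes the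
  -- divergence of p.
  set t : ℝ := ((m + 1) * (2 * m + 3) / (2 * m + 1) : ℝ)⁻¹ with ht
  set c := t • radialHarm m (pdiv p) with hc
  have hcH : ∀ j, IsHarm (m + 1) (c j) := fun j => (isHarm_radialHarm hd j).smul t
  have hp' : ∀ j, IsHarm (m + 1) ((p - c) j) := fun j => (hp j).sub (hcH j)
  have hdiv : pdiv (p - c) = 0 := by
    rw [pdiv_sub, hc, pdiv_smul, pdiv_radialHarm hd, smul_smul, ht, inv_mul_cancel₀, one_smul,
      sub_self]
    positivity
  have hx := isHarm_xdot hp' hdiv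
  set q := polyGrad (xdot (p - c)) with hq
  have hqH : ∀ j, IsHarm (m + 1) (q j) := fun j => hx.pderiv j
  have hqd : pdiv q = 0 := by rw [hq, pdiv_polyGrad, hx.2]
  have hAq : polyA q = (-(m + 1) : ℝ) • q := by
    rw [hq, polyA_polyGrad hx]
    push_cast
    rfl
  -- On the solenoidal remainder, A is the identity minus q, and q is an eigenfield for -(m+1).
  -- Removing q/(m+2) therefore leaves an eigenfield for 1.
  have hAp : polyA (p - c) = (p - c) - q := by
    funext i
    rw [polyA_eq, hdiv]
    simp only [Pi.sub_apply, hq, polyGrad]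
    ring
  have hm2 : (m + 2 : ℝ) ≠ 0 := by positivity
  refine ⟨(m + 2 : ℝ)⁻¹ • q, p - c - (m + 2 : ℝ)⁻¹ • q, c, by abel,
    fun j => (hqH j).smul _, fun j => (hp' j).sub ((hqH j).smul _), hcH, ?_, ?_, ?_, ?_, ?_,
    ⟨_, _, hd, rfl⟩, ?_⟩
  · rw [pdiv_smul, hqd, smul_zero]
  · rw [pdiv_sub, hdiv, pdiv_smul, hqd, smul_zero, sub_zero]
  · rw [polyA_smul, hAq, smul_comm]
  · rw [polyA_sub, hAp, polyA_smul, hAq]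
    match_scalars <;> field_simp
    ring
  · rw [hc, polyA_smul, polyA_radialHarm hd, smul_comm]
  · intro h
    rw [hc, h]
    funext i
    simp [radialHarm]

/-! ### The mass, Dirichlet and spin forms. -/

/-- The class of a Sobolev map in `L²`. -/
def valLp : W12 →ₗ[ℝ] Lp E3 2 σ where
  toFun w := (w : WithLp 2 (Lp E3 2 σ × Lp Grad3 2 σ)).fst
  map_add' _ _ := rfl
  map_smul' _ _ := rfl

/-- The class of the tangential gradient of a Sobolev map in `L²`. -/
def gradLp : W12 →ₗ[ℝ] Lp Grad3 2 σ where
  toFun w := (w : WithLp 2 (Lp E3 2 σ × Lp Grad3 2 σ)).snd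
  map_add' _ _ := rfl
  map_smul' _ _ := rfl

lemma continuous_valLp : Continuous valLp :=
  (WithLp.prod_continuous_ofLp 2 _ _).fst.comp continuous_subtype_val

lemma continuous_gradLp : Continuous gradLp :=
  (WithLp.prod_continuous_ofLp 2 _ _).snd.comp continuous_subtype_val

lemma norm_A_le (w : W12) (x : S2) : ‖A w x‖ ≤ 6 * ‖grad w x‖ := by
  have hx : ‖(x : E3)‖ = 1 := by simp
  have hxj (j : Fin 3) : ‖(x : E3) j‖ ≤ 1 := 
    (PiLp.norm_apply_le (x : E3) j).trans hx.le
  have hG (j : Fin 3) : ‖grad w x j‖ ≤ ‖grad w x‖ := PiLp.norm_apply_le (grad w x) j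
  have hd : ‖divS w x‖ ≤ 3 * ‖grad w x‖ := by
    refine (norm_sum_le_of_le _ (f := fun j => grad w x j j) (n := fun _ => ‖grad w x‖)
      fun j _ => (PiLp.norm_apply_le (grad w x j) j).trans (hG j)).trans ?_
    simp
  have hs : ‖∑ j, (x : E3) j • grad w x j‖ ≤ 3 * ‖grad w x‖ := by
    refine (norm_sum_le_of_le _ (n := fun _ => ‖grad w x‖) fun j _ => ?_).trans ?_
    · rw [norm_smul]
      nlinarith [hxj j, hG j, norm_nonneg (grad w x j), norm_nonneg ((x : E3) j)]
    · simp
  calc ‖A w x‖ ≤ ‖divS w x • (x : E3)‖ + ‖∑ j, (x : E3) j • grad w x j‖ := norm_sub_le _ _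
    _ ≤ 3 * ‖grad w x‖ + 3 * ‖grad w x‖ := by
      rw [norm_smul, hx, mul_one]
      exact add_le_add hd hs
    _ = 6 * ‖grad w x‖ := by ring

lemma memLp_grad (w : W12) : MemLp (grad w) 2 σ := Lp.memLp _

lemma memLp_A (w : W12) : MemLp (A w) 2 σ := by
  refine (memLp_grad w).of_le_mul (c := 6) ?_ (.of_forall fun x => norm_A_le w x)
  have h1 (j : Fin 3) : AEStronglyMeasurable (fun x => grad w x j j) σ := (memLp_entry _ j j).1
  have h2 (j : Fin 3) : AEStronglyMeasurable (fun x => grad w x j) σ := (memLp_row _ j).1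
  have h3 : AEStronglyMeasurable (fun x : S2 => (x : E3)) σ :=
    continuous_subtype_val.aestronglyMeasurable
  have h4 (j : Fin 3) : AEStronglyMeasurable (fun x : S2 => (x : E3) j) σ :=
    ((EuclideanSpace.proj (𝕜 := ℝ) (ι := Fin 3) j).continuous.comp
      continuous_subtype_val).aestronglyMeasurable
  have h5 : AEStronglyMeasurable (fun x => divS w x) σ :=
    Finset.aestronglyMeasurable_fun_sum _ fun j _ => h1 j
  have h6 : AEStronglyMeasurable (fun x : S2 => ∑ j, (x : E3) j • grad w x j) σ :=
    Finset.aestronglyMeasurable_fun_sum _ fun j _ => (h4 j).smul (h2 j)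
  exact (h5.smul h3).sub h6

/-- The class of `A(w)` in `L²`. -/
def ALp : W12 →ₗ[ℝ] Lp E3 2 σ where
  toFun w := (memLp_A w).toLp (A w)
  map_add' v w := by
    rw [← MemLp.toLp_add]
    exact (MemLp.toLp_eq_toLp_iff _ _).2 (A_add v w)
  map_smul' c w := by
    rw [RingHom.id_apply, ← MemLp.toLp_const_smul]
    exact (MemLp.toLp_eq_toLp_iff _ _).2 (A_smul c w)

lemma coeFn_ALp (w : W12) : ALp w =ᵐ[σ] A w := (memLp_A w).coeFn_toLp

lemma norm_gradLp_le (w : W12) : ‖gradLp w‖ ≤ ‖w‖ := by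
  have h : ‖w‖ ^ 2 = ‖valLp w‖ ^ 2 + ‖gradLp w‖ ^ 2 :=
    WithLp.prod_norm_sq_eq_of_L2 (w : WithLp 2 (Lp E3 2 σ × Lp Grad3 2 σ))
  refine (sq_le_sq₀ (norm_nonneg _) (norm_nonneg _)).1 ?_
  rw [h]
  linarith [sq_nonneg ‖valLp w‖]

lemma continuous_ALp : Continuous ALp := by
  refine (ALp.mkContinuous 6 fun w => ?_).continuous
  refine le_trans ?_ (mul_le_mul_of_nonneg_left (norm_gradLp_le w) (by norm_num))
  refine Lp.norm_le_mul_norm_of_ae_le_mul ?_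
  filter_upwards [coeFn_ALp w] with x hx
  rw [hx]
  exact norm_A_le w x

/-- The mean of `⟨v, w⟩`. -/
def massForm (v w : W12) : ℝ := inner ℝ (valLp v) (valLp w)

/-- The mean of `⟨∇v, ∇w⟩`. -/
def dirichletForm (v w : W12) : ℝ := inner ℝ (gradLp v) (gradLp w)

/-- The mean of `⟨v, A(w)⟩`. -/
def spinForm (v w : W12) : ℝ := inner ℝ (valLp v) (ALp w)

lemma massForm_eq_inner (v w : W12) : massForm v w = inner ℝ (valLp v) (valLp w) := rfl

lemma dirichletForm_eq_inner (v w : W12) : dirichletForm v w = inner ℝ (gradLp v) (gradLp w) := rfl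

lemma spinForm_eq_inner (v w : W12) : spinForm v w = inner ℝ (valLp v) (ALp w) := rfl

lemma massForm_add_left (u v w : W12) :
    massForm (u + v) w = massForm u w + massForm v w := by
  simp only [massForm, map_add, inner_add_left]

lemma massForm_sub_left (u v w : W12) :
    massForm (u - v) w = massForm u w - massForm v w := by
  simp only [massForm, map_sub, inner_sub_left]

lemma massForm_smul_left (c : ℝ) (v w : W12) :
    massForm (c • v) w = c * massForm v w := by
  simp only [massForm, map_smul, real_inner_smul_left]

lemma massForm_zero_left (w : W12) : massForm 0 w = 0 := by
  simp only [massForm, map_zero, inner_zero_left]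

lemma massForm_add_right (u v w : W12) :
    massForm w (u + v) = massForm w u + massForm w v := by
  simp only [massForm, map_add, inner_add_right]

lemma massForm_smul_right (c : ℝ) (v w : W12) :
    massForm w (c • v) = c * massForm w v := by
  simp only [massForm, map_smul, real_inner_smul_right]

lemma massForm_zero_right (w : W12) : massForm w 0 = 0 := by
  simp only [massForm, map_zero, inner_zero_right]

lemma dirichletForm_add_left (u v w : W12) :
    dirichletForm (u + v) w = dirichletForm u w + dirichletForm v w := by
  simp only [dirichletForm, map_add, inner_add_left]

lemma dirichletForm_sub_left (u v w : W12) :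
    dirichletForm (u - v) w = dirichletForm u w - dirichletForm v w := by
  simp only [dirichletForm, map_sub, inner_sub_left]

lemma dirichletForm_add_right (u v w : W12) :
    dirichletForm w (u + v) = dirichletForm w u + dirichletForm w v := by
  simp only [dirichletForm, map_add, inner_add_right]

lemma dirichletForm_sub_right (u v w : W12) :
    dirichletForm w (u - v) = dirichletForm w u - dirichletForm w v := by
  simp only [dirichletForm, map_sub, inner_sub_right]

lemma spinForm_add_left (u v w : W12) :
    spinForm (u + v) w = spinForm u w + spinForm v w := by
  simp only [spinForm, map_add, inner_add_left]

lemma spinForm_sub_left (u v w : W12) :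
    spinForm (u - v) w = spinForm u w - spinForm v w := by
  simp only [spinForm, map_sub, inner_sub_left]

lemma spinForm_add_right (u v w : W12) :
    spinForm w (u + v) = spinForm w u + spinForm w v := by
  simp only [spinForm, map_add, inner_add_right]

lemma spinForm_sub_right (u v w : W12) :
    spinForm w (u - v) = spinForm w u - spinForm w v := by
  simp only [spinForm, map_sub, inner_sub_right]

lemma spinForm_smul_right (c : ℝ) (v w : W12) :
    spinForm w (c • v) = c * spinForm w v := by
  simp only [spinForm, map_smul, real_inner_smul_right]

lemma spinForm_zero_right (w : W12) : spinForm w 0 = 0 := by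
  simp only [spinForm, map_zero, inner_zero_right]

lemma massForm_apply (v w : W12) : massForm v w = ∫ x, inner ℝ (val v x) (val w x) ∂σ :=
  L2.inner_def _ _

lemma dirichletForm_apply (v w : W12) :
    dirichletForm v w = ∫ x, inner ℝ (grad v x) (grad w x) ∂σ :=
  L2.inner_def _ _

lemma spinForm_apply (v w : W12) : spinForm v w = ∫ x, inner ℝ (val v x) (A w x) ∂σ := by
  rw [spinForm_eq_inner, L2.inner_def]
  refine integral_congr_ae ?_
  filter_upwards [coeFn_ALp w] with x hx
  rw [hx]
  rfl

lemma inner_eq (v w : W12) : inner ℝ v w = massForm v w + dirichletForm v w :=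
  WithLp.prod_inner_apply (𝕜 := ℝ) (v : WithLp 2 (Lp E3 2 σ × Lp Grad3 2 σ)) _

lemma massForm_comm (v w : W12) : massForm v w = massForm w v :=
  real_inner_comm (valLp w) (valLp v)

lemma dirichletForm_comm (v w : W12) : dirichletForm v w = dirichletForm w v :=
  real_inner_comm (gradLp w) (gradLp v)

lemma massForm_self_nonneg (w : W12) : 0 ≤ massForm w w :=
  real_inner_self_nonneg (x := valLp w)

lemma dirichletForm_self_nonneg (w : W12) : 0 ≤ dirichletForm w w :=
  real_inner_self_nonneg (x := gradLp w)

lemma eq_zero_of_massForm_self {w : W12} (h : massForm w w = 0) : w = 0 := by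
  have h2 : valLp w = 0 := inner_self_eq_zero.1 h
  refine eq_zero_of_val ?_
  change ⇑(valLp w) =ᵐ[σ] 0
  rw [h2]
  exact Lp.coeFn_zero _ _ _

attribute [irreducible] massForm dirichletForm spinForm ALp

lemma Q3bilin_eq (v w : W12) :
    Q3bilin v w = 3 / 4 * dirichletForm v w - 3 / 2 * spinForm v w := by
  rw [Q3bilin, dirichletForm_apply, spinForm_apply]

lemma Q3_eq (w : W12) : Q3 w = 3 / 4 * dirichletForm w w - 3 / 2 * spinForm w w := by
  rw [Q3, dirichletForm_apply, spinForm_apply]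
  simp

lemma massForm_polyMap (v : W12) (p : Fin 3 → MvPolynomial (Fin 3) ℝ) :
    massForm v (polyMap p) = ∫ x : S2, inner ℝ (val v x) (pfield p x) ∂σ := by
  rw [massForm_apply]
  refine integral_congr_ae ?_
  filter_upwards [val_polyMap p] with x hx
  rw [hx]

/-- Replacing tangential by full derivatives is harmless: the normal corrections x_i E p_j
contribute the same term to both halves of A and cancel. -/
lemma A_polyMap (p : Fin 3 → MvPolynomial (Fin 3) ℝ) :
    A (polyMap p) =ᵐ[σ] val (polyMap (polyA p)) := by
  filter_upwards [grad_polyMap p, val_polyMap (polyA p)] with x h1 h2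
  rw [h2]
  ext i
  simp only [A, divS, h1, pgrad_apply, pfield_apply, polyA, tgrad, Fin.sum_univ_three, peval_add, peval_sub,
    peval_mul, peval_X, PiLp.sub_apply, PiLp.add_apply, PiLp.smul_apply, smul_eq_mul]
  ring

lemma spinForm_polyMap (v : W12) (p : Fin 3 → MvPolynomial (Fin 3) ℝ) :
    spinForm v (polyMap p) = massForm v (polyMap (polyA p)) := by
  rw [spinForm_apply, massForm_apply]
  refine integral_congr_ae ?_
  filter_upwards [A_polyMap p] with x hx
  rw [hx]

lemma integral_rot_peval (i j : Fin 3) (f : MvPolynomial (Fin 3) ℝ) :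
    ∫ x : S2, peval (X i * pderiv j f - X j * pderiv i f) x ∂σ = 0 := by
  rcases eq_or_ne i j with rfl | hij
  · simp [peval_zero]
  · rw [← integral_fderiv_rotField hij ((contDiff_peval f).of_le (by exact_mod_cast le_top))]
    refine integral_congr_ae (.of_forall fun x => ?_)
    simp only [fderiv_peval, rotField_apply, peval_sub, peval_mul, peval_X, Fin.sum_univ_three]
    fin_cases i <;> fin_cases j <;> simp <;> ring

lemma integrable_peval (f : MvPolynomial (Fin 3) ℝ) : Integrable (fun x : S2 => peval f x) σ :=
  (memLp_of_continuous ((continuous_peval f).comp continuous_subtype_val)).integrable (q := 2)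
    (by norm_num)

/-- The operator `A` is symmetric on polynomial fields. -/
lemma massForm_polyA_comm (p q : Fin 3 → MvPolynomial (Fin 3) ℝ) :
    massForm (polyMap p) (polyMap (polyA q)) = massForm (polyMap (polyA p)) (polyMap q) := by
  rw [massForm_comm (polyMap (polyA p))]
  have h (p q : Fin 3 → MvPolynomial (Fin 3) ℝ) :
      massForm (polyMap p) (polyMap q) = ∫ x : S2, peval (∑ i, p i * q i) x ∂σ := by
    rw [massForm_polyMap]
    refine integral_congr_ae ?_
    filter_upwards [val_polyMap p] with x hx
    rw [hx, inner_e3]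
    simp only [pfield_apply, peval_sum, peval_mul]
  rw [h, h, ← sub_eq_zero, ← integral_sub (integrable_peval _) (integrable_peval _)]
  -- The antisymmetric part is a sum of rotational derivatives of the products p_i q_j, each of mean
  -- zero.
  have e : (∑ i, p i * polyA q i) - (∑ i, q i * polyA p i) =
      ∑ i, ∑ j, (X i * pderiv j (p i * q j) - X j * pderiv i (p i * q j)) := by
    simp only [polyA, MvPolynomial.pderiv_mul, Fin.sum_univ_three]
    ring
  simp only [← peval_sub, e]
  simp only [peval_sum]
  rw [integral_finsetSum _ fun i _ => integrable_finsetSum _ fun j _ => integrable_peval _]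
  refine Finset.sum_eq_zero fun i _ => ?_
  rw [integral_finsetSum _ fun j _ => integrable_peval _]
  exact Finset.sum_eq_zero fun j _ => integral_rot_peval i j _

/-- The fields whose components are harmonic homogeneous polynomials of degree `k`. -/
def harmFields (k : ℕ) : Submodule ℝ (Fin 3 → MvPolynomial (Fin 3) ℝ) where
  carrier := {p | ∀ j, IsHarm k (p j)}
  zero_mem' := fun _ => IsHarm.zero k
  add_mem' := fun hp hq j => (hp j).add (hq j)
  smul_mem' := fun c _ hp j => (hp j).smul c

/-- The rows of the gradient of p are admissible tangent test fields for the weak gradient of v,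
with divergence -k(k+1) p_j. Hence v may be any Sobolev map. -/
lemma dirichletForm_polyMap (v : W12) {k : ℕ} {p : Fin 3 → MvPolynomial (Fin 3) ℝ}
    (hp : p ∈ harmFields k) :
    dirichletForm v (polyMap p) = k * (k + 1) * massForm v (polyMap p) := by
  have e : dirichletForm v (polyMap p) =
      ∑ j, ∫ x : S2, inner ℝ (grad v x j) (pfield (tgrad (p j)) x) ∂σ := by
    have hi (j : Fin 3) : Integrable
        (fun x : S2 => inner ℝ (grad v x j) (pfield (tgrad (p j)) x)) σ :=
      integrable_row _ j (isTangentTest_tgrad (p j))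
    rw [dirichletForm_apply, ← integral_finsetSum _ fun j _ => hi j]
    refine integral_congr_ae ?_
    filter_upwards [grad_polyMap p] with x hx
    rw [hx, PiLp.inner_apply]
    rfl
  have e2 (j : Fin 3) : ∫ x : S2, inner ℝ (grad v x j) (pfield (tgrad (p j)) x) ∂σ =
      k * (k + 1) * ∫ x : S2, val v x j * peval (p j) x ∂σ := by
    refine (v.2.2 j _ (isTangentTest_tgrad (p j))).trans ?_
    rw [← integral_const_mul, ← integral_neg]
    refine integral_congr_ae (.of_forall fun x => ?_)
    simp only [divSmooth_tgrad, (hp j).2, euler_of_isHomogeneous (hp j).1,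
      euler_of_isHomogeneous (isHomogeneous_smul _ (hp j).1), peval_sub, peval_smul, peval_zero]
    change -(val v x j * _) = _
    ring
  have e3 (j : Fin 3) : Integrable (fun x : S2 => val v x j * peval (p j) x) σ :=
    (memLp_comp _ j).integrable_mul
      (memLp_of_continuous ((continuous_peval (p j)).comp continuous_subtype_val))
  rw [e, massForm_polyMap, Finset.sum_congr rfl fun j _ => e2 j, ← Finset.mul_sum,
    ← integral_finsetSum _ fun j _ => e3 j]
  congr 1
  refine integral_congr_ae (.of_forall fun x => ?_)
  simp only [inner_e3, pfield_apply]

lemma polyMap_congr {p q : Fin 3 → MvPolynomial (Fin 3) ℝ}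
    (h : ∀ x : S2, ∀ j, peval (p j) x = peval (q j) x) : polyMap p = polyMap q := by
  refine eq_of_val ?_
  filter_upwards [val_polyMap p, val_polyMap q] with x h1 h2
  rw [h1, h2]
  ext j
  exact h x j

/-! ### Spherical harmonics: totality and orthogonality. -/

/-- The Sobolev maps whose components are spherical harmonics of order `k`. -/
def Harm (k : ℕ) : Submodule ℝ W12 := (harmFields k).map polyMap

lemma isHomogeneous_lap {n : ℕ} {f : MvPolynomial (Fin 3) ℝ} (hf : f.IsHomogeneous n) :
    (lap f).IsHomogeneous (n - 2) :=
  MvPolynomial.IsHomogeneous.sum _ _ _ fun _ _ => hf.pderiv.pderiv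

lemma isHomogeneous_iterate_lap {n : ℕ} {f : MvPolynomial (Fin 3) ℝ} (hf : f.IsHomogeneous n)
    (m : ℕ) : (lap^[m] f).IsHomogeneous (n - 2 * m) := by
  induction m with
  | zero => exact hf
  | succ m ih =>
    rw [Function.iterate_succ_apply']
    convert isHomogeneous_lap ih using 1
    omega

lemma lap_zero : lap 0 = 0 := by simp [lap]

lemma iterate_lap_zero (m : ℕ) : lap^[m] 0 = 0 := Function.iterate_fixed lap_zero m

lemma iterate_lap_eq_zero {m n : ℕ} (hmn : n < 2 * m) {f : MvPolynomial (Fin 3) ℝ}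
    (hf : f.IsHomogeneous n) : lap^[m] f = 0 := by
  induction m generalizing n f with
  | zero => omega
  | succ m ih =>
    rw [Function.iterate_succ_apply]
    rcases lt_or_ge n 2 with h | h
    · have : lap f = 0 := Finset.sum_eq_zero fun i _ =>
        pderiv_of_isHomogeneous_zero ((show n - 1 = 0 by omega) ▸ hf.pderiv) i
      rw [this, iterate_lap_zero]
    · exact ih (by omega) (isHomogeneous_lap hf)

lemma iterate_lap_smul (m : ℕ) (c : ℝ) (f : MvPolynomial (Fin 3) ℝ) :
    lap^[m] (c • f) = c • lap^[m] f := by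
  induction m generalizing f with
  | zero => rfl
  | succ m ih => rw [Function.iterate_succ_apply, lap_smul, ih, Function.iterate_succ_apply]

lemma iterate_lap_sub (m : ℕ) (f g : MvPolynomial (Fin 3) ℝ) :
    lap^[m] (f - g) = lap^[m] f - lap^[m] g := by
  induction m generalizing f g with
  | zero => rfl
  | succ m ih =>
    rw [Function.iterate_succ_apply, lap_sub, ih, Function.iterate_succ_apply,
      Function.iterate_succ_apply]

lemma isHomogeneous_rsq_pow_mul {n : ℕ} {u : MvPolynomial (Fin 3) ℝ} (hu : u.IsHomogeneous n)
    (m : ℕ) : (rsq ^ m * u).IsHomogeneous (2 * m + n) :=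
  (isHomogeneous_rsq.pow m).mul hu

lemma exists_lap_rsq_pow_mul {n : ℕ} {u : MvPolynomial (Fin 3) ℝ} (hu : IsHarm n u) (m : ℕ) :
    ∃ c : ℝ, 0 < c ∧ lap (rsq ^ (m + 1) * u) = c • (rsq ^ m * u) := by
  induction m with
  | zero =>
    refine ⟨6 + 4 * n, by positivity, ?_⟩
    rw [zero_add, pow_one, pow_zero, one_mul, lap_rsq_mul, hu.2, euler_of_isHomogeneous hu.1,
      mul_zero]
    module
  | succ m ih =>
    obtain ⟨c, hc, h⟩ := ih
    refine ⟨6 + 4 * (2 * (m + 1) + n : ℕ) + c, by positivity, ?_⟩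
    rw [pow_succ' rsq (m + 1), mul_assoc, lap_rsq_mul, h,
      euler_of_isHomogeneous (isHomogeneous_rsq_pow_mul hu.1 (m + 1)), mul_smul_comm, ← mul_assoc,
      ← pow_succ']
    module

/-- Only c ≠ 0 matters: applying Δ^m recovers the harmonic factor u from |x|^(2m) u. -/
lemma exists_iterate_lap_rsq_pow_mul {n : ℕ} {u : MvPolynomial (Fin 3) ℝ} (hu : IsHarm n u)
    (m : ℕ) : ∃ c : ℝ, 0 < c ∧ lap^[m] (rsq ^ m * u) = c • u := by
  induction m with
  | zero => exact ⟨1, one_pos, by simp⟩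
  | succ m ih =>
    obtain ⟨c, hc, h⟩ := ih
    obtain ⟨c', hc', h'⟩ := exists_lap_rsq_pow_mul hu m
    exact ⟨c' * c, mul_pos hc' hc, by
      rw [Function.iterate_succ_apply, h', iterate_lap_smul, h, smul_smul]⟩

lemma peval_rsq (x : S2) : peval rsq x = 1 := by
  rw [rsq, peval_sum]
  refine (Finset.sum_congr rfl fun i _ => ?_).trans (sum_sq_coord x)
  rw [sq, peval_mul, peval_X, sq]

lemma peval_rsq_pow_mul (m : ℕ) (u : MvPolynomial (Fin 3) ℝ) (x : S2) :
    peval (rsq ^ m * u) x = peval u x := by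
  induction m with
  | zero => simp
  | succ m ih => rw [pow_succ', mul_assoc, peval_mul, peval_rsq, ih, one_mul]

lemma polyMap_single_mem_of_isHarm {n : ℕ} {u : MvPolynomial (Fin 3) ℝ} (hu : IsHarm n u)
    (j : Fin 3) : polyMap (Pi.single j u) ∈ ⨆ k, Harm k := by
  refine Submodule.mem_iSup_of_mem n ⟨_, fun l => ?_, rfl⟩
  rcases eq_or_ne l j with rfl | hl
  · simpa using hu
  · simpa [hl] using IsHarm.zero n

/-- Induction on the power of Δ that kills f: if Δ^(m+1) f = 0, then u = Δ^m f is harmonic, and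
subtracting a multiple of |x|^(2m) u lowers the power. On the sphere the subtracted term is a
multiple of the harmonic u. -/
lemma polyMap_single_mem_of_isHomogeneous {n : ℕ} {f : MvPolynomial (Fin 3) ℝ}
    (hf : f.IsHomogeneous n) (j : Fin 3) : polyMap (Pi.single j f) ∈ ⨆ k, Harm k := by
  have key : ∀ m, ∀ f : MvPolynomial (Fin 3) ℝ, f.IsHomogeneous n → lap^[m] f = 0 →
      polyMap (Pi.single j f) ∈ ⨆ k, Harm k := by
    intro m
    induction m with
    | zero =>
      intro f _ h
      rw [show f = 0 from h, Pi.single_zero, map_zero]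
      exact zero_mem _
    | succ m ih =>
      intro f hf h
      -- For n < 2m the iterate already vanishes for degree reasons; otherwise the natural
      -- subtraction n - 2m is the true degree of u.
      rcases lt_or_ge n (2 * m) with hnm | hnm
      · exact ih f hf (iterate_lap_eq_zero hnm hf)
      · have hu : IsHarm (n - 2 * m) (lap^[m] f) :=
          ⟨isHomogeneous_iterate_lap hf m, (Function.iterate_succ_apply' lap m f).symm.trans h⟩
        obtain ⟨c, hc, hcu⟩ := exists_iterate_lap_rsq_pow_mul hu m
        have h1 : (rsq ^ m * lap^[m] f).IsHomogeneous n := by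
          convert isHomogeneous_rsq_pow_mul hu.1 m using 1
          omega
        have h2 := ih (f - c⁻¹ • (rsq ^ m * lap^[m] f)) (hf.sub (isHomogeneous_smul _ h1)) (by
          rw [iterate_lap_sub, iterate_lap_smul, hcu, smul_smul, inv_mul_cancel₀ hc.ne', one_smul,
            sub_self])
        have h3 := Submodule.add_mem _ h2
          (Submodule.smul_mem _ c⁻¹ (polyMap_single_mem_of_isHarm hu j))
        rw [← map_smul, ← map_add] at h3
        convert h3 using 1
        refine polyMap_congr fun x l => ?_
        rcases eq_or_ne l j with rfl | hl
        · simp [peval_add, peval_sub, peval_smul, peval_rsq_pow_mul]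
        · simp [hl]
  exact key (n + 1) f hf (iterate_lap_eq_zero (by omega) hf)

/-- Polynomial fields restricted to the sphere are sums of spherical harmonics. -/
lemma polyMap_mem_iSup_Harm (p : Fin 3 → MvPolynomial (Fin 3) ℝ) :
    polyMap p ∈ ⨆ k, Harm k := by
  rw [← Finset.univ_sum_single p, map_sum]
  refine Submodule.sum_mem _ fun j _ => ?_
  rw [← MvPolynomial.sum_homogeneousComponent (p j)]
  have e : (Pi.single j (∑ i ∈ Finset.range ((p j).totalDegree + 1),
      MvPolynomial.homogeneousComponent i (p j)) : Fin 3 → MvPolynomial (Fin 3) ℝ) =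
      ∑ i ∈ Finset.range ((p j).totalDegree + 1),
        Pi.single j (MvPolynomial.homogeneousComponent i (p j)) :=
    map_sum (AddMonoidHom.single (fun _ : Fin 3 => MvPolynomial (Fin 3) ℝ) j) _ _
  rw [e, map_sum]
  exact Submodule.sum_mem _ fun i _ => polyMap_single_mem_of_isHomogeneous
    (MvPolynomial.homogeneousComponent_isHomogeneous i (p j)) j

/-- A Sobolev map that is square orthogonal to all spherical harmonics vanishes. -/
lemma eq_zero_of_massForm_Harm {w : W12} (h : ∀ k, ∀ v ∈ Harm k, massForm w v = 0) : w = 0 := by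
  have h1 (p : Fin 3 → MvPolynomial (Fin 3) ℝ) : massForm w (polyMap p) = 0 := by
    have : (⨆ k, Harm k) ≤ LinearMap.ker ((innerₛₗ ℝ (valLp w)).comp valLp) :=
      iSup_le fun k v hv => LinearMap.mem_ker.2 ((massForm_eq_inner w v).symm.trans (h k v hv))
    exact (massForm_eq_inner w _).trans (LinearMap.mem_ker.1 (this (polyMap_mem_iSup_Harm p)))
  refine eq_zero_of_val ?_
  have h2 (j : Fin 3) : (fun x => val w x j) =ᵐ[σ] 0 := by
    refine ae_eq_zero_of_integral_peval (memLp_comp _ j) fun p => ?_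
    rw [← h1 (Pi.single j p), massForm_polyMap]
    refine integral_congr_ae (.of_forall fun x => ?_)
    simp only [inner_e3, pfield_apply]
    fin_cases j <;> simp [Fin.sum_univ_three, peval_zero]
  have h3 : ∀ᵐ x ∂σ, ∀ j, val w x j = 0 := ae_all_iff.2 h2
  filter_upwards [h3] with x hx
  ext j
  exact hx j

lemma dirichletForm_Harm (v : W12) {k : ℕ} {w : W12} (hw : w ∈ Harm k) :
    dirichletForm v w = k * (k + 1) * massForm v w := by
  obtain ⟨p, hp, rfl⟩ := hw
  exact dirichletForm_polyMap v hp

/-- The spherical harmonics are total in the Sobolev space. -/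
lemma iSup_Harm_topologicalClosure : (⨆ k, Harm k).topologicalClosure = ⊤ := by
  rw [Submodule.topologicalClosure_eq_top_iff, Submodule.eq_bot_iff]
  intro w hw
  refine eq_zero_of_massForm_Harm fun k v hv => ?_
  have h := (Submodule.mem_orthogonal' _ _).1 hw v (Submodule.mem_iSup_of_mem k hv)
  -- On degree k the Sobolev product is 1 + k(k+1) times the mass, so Sobolev orthogonality gives L²
  -- orthogonality.
  rw [inner_eq, dirichletForm_Harm _ hv] at h
  have : (0 : ℝ) < 1 + k * (k + 1) := by positivity
  have h2 : (1 + k * (k + 1) : ℝ) * massForm w v = 0 := by linarith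
  exact (mul_eq_zero.1 h2).resolve_left this.ne'

/-- Symmetry of the Dirichlet form gives (k(k+1) - l(l+1)) ⟨v, w⟩ = 0, and the factor is
(k-l)(k+l+1). -/
lemma massForm_Harm_of_ne {k l : ℕ} (hkl : k ≠ l) {v w : W12} (hv : v ∈ Harm k)
    (hw : w ∈ Harm l) : massForm v w = 0 := by
  have h1 := dirichletForm_Harm v hw
  rw [dirichletForm_comm, dirichletForm_Harm w hv, massForm_comm w v] at h1
  have h2 : (((k : ℝ) - l) * (k + l + 1)) * massForm v w = 0 := by linarith
  have h3 : ((k : ℝ) - l) ≠ 0 := sub_ne_zero.2 (by exact_mod_cast hkl)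
  have h4 : ((k : ℝ) + l + 1) ≠ 0 := by positivity
  exact (mul_eq_zero.1 h2).resolve_left (mul_ne_zero h3 h4)

/-! ### Eigenvectors of A and the spaces they span. -/

/-- The Sobolev map `w` is a (weak) eigenvector of `A` for the eigenvalue `μ`. -/
def IsEigen (μ : ℝ) (w : W12) : Prop := ∀ v, spinForm v w = μ * massForm v w

lemma isEigen_polyMap {μ : ℝ} {p : Fin 3 → MvPolynomial (Fin 3) ℝ} (h : polyA p = μ • p) :
    IsEigen μ (polyMap p) := fun v => by
  rw [spinForm_polyMap, h, polyMap.map_smul, massForm_smul_right]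

lemma isEigen_of_ae {w : W12} (h : A w =ᵐ[σ] val w) : IsEigen 1 w := fun v => by
  rw [spinForm_apply, massForm_apply, one_mul]
  refine integral_congr_ae ?_
  filter_upwards [h] with x hx
  rw [hx]

/-- Symmetry is needed only between polynomial maps: every eigenvector in use is one, and the
coercivity estimate is proved on polynomial maps before passing to the closure. -/
lemma spinForm_comm {v w : W12} (hv : v ∈ LinearMap.range polyMap)
    (hw : w ∈ LinearMap.range polyMap) : spinForm v w = spinForm w v := by
  obtain ⟨p, rfl⟩ := hv
  obtain ⟨q, rfl⟩ := hw
  rw [spinForm_polyMap, spinForm_polyMap, massForm_polyA_comm, massForm_comm]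

lemma Harm_le_range (k : ℕ) : Harm k ≤ LinearMap.range polyMap := LinearMap.map_le_range

lemma polyMap_mem_Harm {k : ℕ} {p : Fin 3 → MvPolynomial (Fin 3) ℝ} (hp : p ∈ harmFields k) :
    polyMap p ∈ Harm k := ⟨p, hp, rfl⟩

lemma massForm_eigen_of_ne {v w : W12} {μ ν : ℝ} (hμν : μ ≠ ν)
    (hv : v ∈ LinearMap.range polyMap) (hw : w ∈ LinearMap.range polyMap) (hμ : IsEigen μ v)
    (hν : IsEigen ν w) : massForm v w = 0 := by
  have h := spinForm_comm hv hw
  rw [hμ, hν, massForm_comm w v] at h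
  have h2 : (μ - ν) * massForm v w = 0 := by linarith
  exact (mul_eq_zero.1 h2).resolve_left (sub_ne_zero.2 hμν)

lemma polyA_of_mem_harmFields_zero {p : Fin 3 → MvPolynomial (Fin 3) ℝ} (hp : p ∈ harmFields 0) :
    polyA p = 0 := by
  funext i
  simp [polyA, pderiv_of_isHomogeneous_zero (hp _).1]

lemma polyA_mem_harmFields {k : ℕ} {p : Fin 3 → MvPolynomial (Fin 3) ℝ} (hp : p ∈ harmFields k) :
    polyA p ∈ harmFields k := by
  rcases k with _ | m
  · rw [polyA_of_mem_harmFields_zero hp]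
    exact zero_mem _
  · obtain ⟨a, b, c, rfl, ha, hb, hc, -, -, hAa, hAb, hAc, -⟩ := exists_eigen_decomposition hp
    rw [polyA_add, polyA_add, hAa, hAb, hAc]
    exact add_mem (add_mem (Submodule.smul_mem (harmFields (m + 1)) _ ha) hb)
      (Submodule.smul_mem (harmFields (m + 1)) _ hc)

lemma spinForm_Harm_of_ne {k l : ℕ} (hkl : k ≠ l) {v w : W12} (hv : v ∈ Harm k)
    (hw : w ∈ Harm l) : spinForm v w = 0 := by
  obtain ⟨p, hp, rfl⟩ := hw
  rw [spinForm_polyMap]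
  exact massForm_Harm_of_ne hkl hv (polyMap_mem_Harm (polyA_mem_harmFields hp))

/-- The inclusion of the sphere as a Sobolev map. -/
def position : W12 := polyMap X

lemma isHarm_X (j : Fin 3) : IsHarm 1 (X j) :=
  ⟨MvPolynomial.isHomogeneous_X _ _, Finset.sum_eq_zero fun i _ => by
    rw [pderiv_X_ite]; split_ifs <;> simp⟩

lemma position_mem_Harm : position ∈ Harm 1 := polyMap_mem_Harm fun j => isHarm_X j

/-- In degree one the third eigenspace is thus the line of the position field, the one mode where Q₃
is negative. -/
lemma radialHarm_zero {d : MvPolynomial (Fin 3) ℝ} (hd : IsHarm 0 d) :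
    ∃ r : ℝ, radialHarm 0 d = r • X := by
  obtain ⟨r, hr⟩ : ∃ r, d = MvPolynomial.C r := by
    have h := hd.1
    rw [← MvPolynomial.totalDegree_zero_iff_isHomogeneous,
      MvPolynomial.totalDegree_eq_zero_iff_eq_C] at h
    exact ⟨_, h⟩
  refine ⟨r, funext fun i => ?_⟩
  rw [radialHarm, pderiv_of_isHomogeneous_zero hd.1, hr, Pi.smul_apply,
    MvPolynomial.smul_eq_C_mul (X i) r, mul_zero, smul_zero, sub_zero, mul_comm]

lemma isHarm_one : IsHarm 0 1 := ⟨MvPolynomial.isHomogeneous_one _ _, by simp [lap]⟩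

lemma isEigen_position : IsEigen 2 position := by
  have h := polyA_radialHarm isHarm_one
  have e : radialHarm 0 1 = X := by
    funext i
    simp [radialHarm]
  rw [e] at h
  refine isEigen_polyMap ?_
  simpa using h

lemma massForm_position (w : W12) :
    massForm w position = ∫ x : S2, inner ℝ (val w x) (x : E3) ∂σ := by
  rw [position, massForm_polyMap]
  refine integral_congr_ae (.of_forall fun x => ?_)
  simp only [inner_e3, pfield_apply, peval_X]

lemma massForm_position_self : massForm position position = 1 := by
  rw [massForm_position, integral_congr_ae (g := fun _ => (1 : ℝ))]
  · simp
  · filter_upwards [val_polyMap X] with x hx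
    have hx' : val position x = pfield X x := hx
    simp only [hx', inner_e3, pfield_apply, peval_X]
    exact (Finset.sum_congr rfl fun i _ => (sq _).symm).trans (sum_sq_coord x)

lemma mem_H_iff (w : W12) :
    w ∈ H ↔ (∀ v ∈ Harm 0, massForm w v = 0) ∧ massForm w position = 0 := by
  rw [massForm_position]
  refine and_congr ?_ Iff.rfl
  have key (c : E3) : ∫ x, inner ℝ (val w x) c ∂σ = inner ℝ c (∫ x, val w x ∂σ) := by
    rw [← integral_inner (integrable_val w)]
    exact integral_congr_ae (.of_forall fun x => real_inner_comm _ _)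
  constructor
  · rintro h _ ⟨p, hp, rfl⟩
    have hc (j : Fin 3) : p j = MvPolynomial.C ((p j).coeff 0) := by
      rw [← MvPolynomial.totalDegree_eq_zero_iff_eq_C,
        MvPolynomial.totalDegree_zero_iff_isHomogeneous]
      exact (hp j).1
    have h2 := key (WithLp.toLp 2 fun j => (p j).coeff 0)
    rw [h, inner_zero_right] at h2
    rw [massForm_polyMap, ← h2]
    refine integral_congr_ae (.of_forall fun x => ?_)
    simp only [inner_e3, pfield_apply]
    refine Finset.sum_congr rfl fun j _ => ?_
    conv_lhs => rw [hc j, peval_C]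
  · intro h
    refine inner_self_eq_zero (𝕜 := ℝ).1 ?_
    rw [← key]
    set c : E3 := ∫ x, val w x ∂σ
    rw [← h (polyMap fun j => MvPolynomial.C (c j))
      (polyMap_mem_Harm fun j => ⟨MvPolynomial.isHomogeneous_C _ _, by simp [lap]⟩),
      massForm_polyMap]
    refine integral_congr_ae (.of_forall fun x => ?_)
    simp only [inner_e3, pfield_apply, peval_C]

lemma mem_H_of_Harm {k : ℕ} (hk : 1 ≤ k) {w : W12} (hw : w ∈ Harm k)
    (hx : massForm w position = 0) : w ∈ H :=
  (mem_H_iff w).2 ⟨fun _ hv => massForm_Harm_of_ne (by omega) hw hv, hx⟩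

lemma mem_H_of_Harm_two_le {k : ℕ} (hk : 2 ≤ k) {w : W12} (hw : w ∈ Harm k) : w ∈ H :=
  mem_H_of_Harm (by omega) hw (massForm_Harm_of_ne (by omega) hw position_mem_Harm)

lemma isRestriction_polyMap (p : Fin 3 → MvPolynomial (Fin 3) ℝ) : IsRestriction p (polyMap p) := by
  filter_upwards [val_polyMap p] with x hx j
  rw [hx]
  rfl

lemma eq_polyMap_of_isRestriction {p : Fin 3 → MvPolynomial (Fin 3) ℝ} {w : W12}
    (h : IsRestriction p w) : w = polyMap p := by
  refine eq_of_val ?_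
  filter_upwards [h, val_polyMap p] with x h1 h2
  rw [h2]
  ext j
  exact h1 j

lemma mem_Hk_iff {k : ℕ} {w : W12} : w ∈ Hk k ↔ w ∈ H ∧ w ∈ Harm k := by
  refine and_congr_right fun _ => ⟨?_, ?_⟩
  · rintro ⟨p, hp, hpw⟩
    rw [eq_polyMap_of_isRestriction hpw]
    exact polyMap_mem_Harm hp
  · rintro ⟨p, hp, rfl⟩
    exact ⟨p, hp, isRestriction_polyMap p⟩

lemma mem_HkSol_iff {k : ℕ} {w : W12} :
    w ∈ HkSol k ↔ w ∈ H ∧ ∃ p ∈ harmFields k, pdiv p = 0 ∧ w = polyMap p := by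
  refine and_congr_right fun _ => ⟨?_, ?_⟩
  · rintro ⟨p, hp, hpw, hd⟩
    exact ⟨p, hp, hd, eq_polyMap_of_isRestriction hpw⟩
  · rintro ⟨p, hp, hd, rfl⟩
    exact ⟨p, hp, isRestriction_polyMap p, hd⟩

lemma Hk2_spec {k : ℕ} {w : W12} (hw : w ∈ Hk2 k) : w ∈ H ∧ w ∈ Harm k ∧ IsEigen 1 w := by
  obtain ⟨h1, p, hp, -, rfl⟩ := mem_HkSol_iff.1 hw.1
  exact ⟨h1, polyMap_mem_Harm hp, isEigen_of_ae hw.2⟩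

lemma inner_Harm (v : W12) {k : ℕ} {w : W12} (hw : w ∈ Harm k) :
    inner ℝ v w = (1 + k * (k + 1)) * massForm v w := by
  rw [inner_eq, dirichletForm_Harm v hw]
  ring

lemma inner_eq_zero_iff_massForm (v : W12) {k : ℕ} {w : W12} (hw : w ∈ Harm k) :
    inner ℝ v w = 0 ↔ massForm v w = 0 := by
  have : (1 + k * (k + 1) : ℝ) ≠ 0 := by positivity
  rw [inner_Harm v hw, mul_eq_zero, or_iff_right this]

/-- Split w into eigenfields a + b + c. The solenoidal part a + b lies in `HkSol`, the constraints
of `H` being automatic in degree at least two, so w is orthogonal to it. As c is orthogonal to a and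
b by symmetry, a + b = 0 and w = c. -/
lemma Hk3_spec {m : ℕ} {w : W12} (hw : w ∈ Hk3 (m + 2)) :
    w ∈ H ∧ w ∈ Harm (m + 2) ∧ IsEigen (m + 3) w := by
  obtain ⟨hH, hk⟩ := mem_Hk_iff.1 hw.1
  refine ⟨hH, hk, ?_⟩
  obtain ⟨p, hp, rfl⟩ := hk
  obtain ⟨a, b, c, rfl, ha, hb, hc, hda, hdb, hAa, hAb, hAc, -⟩ := exists_eigen_decomposition hp
  push_cast at hAa hAc
  have hab : a + b ∈ harmFields (m + 2) := add_mem (S := Submodule ℝ _) ha hb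
  have hdab : pdiv (a + b) = 0 := by rw [pdiv_add, hda, hdb, add_zero]
  have hsol : polyMap (a + b) ∈ HkSol (m + 2) := mem_HkSol_iff.2
    ⟨mem_H_of_Harm_two_le (by omega) (polyMap_mem_Harm hab), _, hab, hdab, rfl⟩
  have h0 := (Submodule.mem_orthogonal' _ _).1 hw.2 _ hsol
  rw [inner_eq_zero_iff_massForm _ (polyMap_mem_Harm hab)] at h0
  have h1 : massForm (polyMap c) (polyMap a) = 0 :=
    massForm_eigen_of_ne (by have := m.cast_nonneg (α := ℝ); intro h; linarith) ⟨_, rfl⟩ ⟨_, rfl⟩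
      (isEigen_polyMap hAc) (isEigen_polyMap hAa)
  have h2 : massForm (polyMap c) (polyMap b) = 0 :=
    massForm_eigen_of_ne (ν := 1) (by have := m.cast_nonneg (α := ℝ); intro h; linarith)
      ⟨_, rfl⟩ ⟨_, rfl⟩ (isEigen_polyMap hAc) (isEigen_polyMap (by rw [hAb, one_smul]))
  have h3 : polyMap (a + b) = 0 := by
    refine eq_zero_of_massForm_self ?_
    have h4 : massForm (polyMap c) (polyMap (a + b)) = 0 := by
      rw [polyMap.map_add a b, massForm_add_right, h1, h2, add_zero]
    rwa [polyMap.map_add (a + b) c, massForm_add_left, h4, add_zero] at h0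
  rw [polyMap.map_add (a + b) c, h3, zero_add]
  refine isEigen_polyMap ?_
  rw [hAc]
  congr 1
  ring

/-- For μ = -k, 1, k+1 the coefficient is 3/4 times k(k+3), (k-1)(k+2) and (k+1)(k-2). For k ≥ 1 its
only zeros are (k, μ) = (1, 1) and (2, 3). -/
lemma Q3bilin_of_isEigen {k : ℕ} {μ : ℝ} {w : W12} (hw : w ∈ Harm k) (he : IsEigen μ w) (v : W12) :
    Q3bilin v w = (3 / 4 * (k * (k + 1)) - 3 / 2 * μ) * massForm v w := by
  rw [Q3bilin_eq, dirichletForm_Harm v hw, he v]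
  ring

lemma Hk2_one_isOrtho_Hk3_two : Hk2 1 ⟂ Hk3 2 := by
  rw [Submodule.isOrtho_iff_inner_eq]
  intro v hv w hw
  have h2 := (Hk3_spec (m := 0) hw).2.1
  rw [inner_eq_zero_iff_massForm _ h2]
  exact massForm_Harm_of_ne (by norm_num) (Hk2_spec hv).2.1 h2

lemma H0_le_H : H0 ≤ H :=
  sup_le (fun _ hw => (Hk2_spec hw).1) fun _ hw => (Hk3_spec (m := 0) hw).1

lemma H0_le_Harm : H0 ≤ Harm 1 ⊔ Harm 2 :=
  sup_le_sup (fun _ hw => (Hk2_spec hw).2.1) fun _ hw => (Hk3_spec (m := 0) hw).2.1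

lemma H0_le_range : H0 ≤ LinearMap.range polyMap :=
  H0_le_Harm.trans (sup_le (Harm_le_range 1) (Harm_le_range 2))

lemma Q3bilin_H0 (v : W12) {w : W12} (hw : w ∈ H0) : Q3bilin v w = 0 := by
  have h (a b : W12) : Q3bilin v (a + b) = Q3bilin v a + Q3bilin v b := by
    simp only [Q3bilin_eq, dirichletForm_add_right, spinForm_add_right]
    ring
  obtain ⟨a, ha, b, hb, rfl⟩ := Submodule.mem_sup.1 hw
  obtain ⟨-, ha1, ha2⟩ := Hk2_spec ha
  obtain ⟨-, hb1, hb2⟩ := Hk3_spec (m := 0) hb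
  rw [h, Q3bilin_of_isEigen ha1 ha2, Q3bilin_of_isEigen hb1 hb2]
  norm_num

instance (k : ℕ) : FiniteDimensional ℝ (harmFields k) := by
  have : Module.Finite ℝ (MvPolynomial.homogeneousSubmodule (Fin 3) ℝ k) :=
    Module.Finite.iff_fg.2 (MvPolynomial.homogeneousSubmodule_fg _ _ k)
  let f : harmFields k →ₗ[ℝ] (Fin 3 → MvPolynomial.homogeneousSubmodule (Fin 3) ℝ k) :=
    LinearMap.pi fun j => LinearMap.codRestrict _
      ((LinearMap.proj j).comp (harmFields k).subtype) fun p => (p.2 j).1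
  refine Module.Finite.of_injective f fun p q h => ?_
  refine Subtype.ext (funext fun j => ?_)
  exact congrArg Subtype.val (congrFun h j)

instance (k : ℕ) : FiniteDimensional ℝ (Harm k) :=
  inferInstanceAs (FiniteDimensional ℝ ((harmFields k).map polyMap))

instance : FiniteDimensional ℝ H0 := Submodule.finiteDimensional_of_le H0_le_Harm

instance : H0.HasOrthogonalProjection := inferInstance

/-! ### The penalised gap form, degree by degree. -/

/-- The bilinear form `½⟨∇v, ∇w⟩ - 3/2 ⟨v, A(w)⟩ + 2 ⟨v, x⟩⟨w, x⟩`, in the mean. -/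
def gapForm (v w : W12) : ℝ :=
  1 / 2 * dirichletForm v w - 3 / 2 * spinForm v w +
    2 * (massForm v position * massForm w position)

lemma gapForm_add_left (u v w : W12) : gapForm (u + v) w = gapForm u w + gapForm v w := by
  simp only [gapForm, massForm_add_left, dirichletForm_add_left, spinForm_add_left]
  ring

lemma gapForm_add_right (u v w : W12) : gapForm w (u + v) = gapForm w u + gapForm w v := by
  simp only [gapForm, massForm_add_left, dirichletForm_add_right, spinForm_add_right]
  ring

lemma gapForm_sum (s : Finset ℕ) (f : ℕ → W12) :
    gapForm (∑ k ∈ s, f k) (∑ k ∈ s, f k) = ∑ k ∈ s, ∑ l ∈ s, gapForm (f k) (f l) := by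
  have h1 (w : W12) : gapForm (∑ k ∈ s, f k) w = ∑ k ∈ s, gapForm (f k) w :=
    map_sum (AddMonoidHom.mk' (fun v => gapForm v w) fun u v => gapForm_add_left u v w) f s
  have h2 (w : W12) : gapForm w (∑ k ∈ s, f k) = ∑ k ∈ s, gapForm w (f k) :=
    map_sum (AddMonoidHom.mk' (gapForm w) fun u v => gapForm_add_right u v w) f s
  rw [h1]
  exact Finset.sum_congr rfl fun k _ => h2 (f k)

/-- The penalty couples no two degrees, since the position field has degree one and at most one of
k, l equals 1. -/
lemma gapForm_Harm_of_ne {k l : ℕ} (hkl : k ≠ l) {v w : W12} (hv : v ∈ Harm k)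
    (hw : w ∈ Harm l) : gapForm v w = 0 := by
  rw [gapForm, dirichletForm_Harm v hw, massForm_Harm_of_ne hkl hv hw,
    spinForm_Harm_of_ne hkl hv hw]
  rcases eq_or_ne k 1 with rfl | hk
  · rw [massForm_Harm_of_ne hkl.symm hw position_mem_Harm]
    ring
  · rw [massForm_Harm_of_ne hk hv position_mem_Harm]
    ring

/-- The mass and the spin form of a sum of three eigenvectors of `A` for distinct eigenvalues. -/
lemma massForm_spinForm_of_eigen {α β γ : ℝ} (hαβ : α ≠ β) (hαγ : α ≠ γ) (hβγ : β ≠ γ) {a b c : W12}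
    (ha : a ∈ LinearMap.range polyMap) (hb : b ∈ LinearMap.range polyMap)
    (hc : c ∈ LinearMap.range polyMap) (hα : IsEigen α a) (hβ : IsEigen β b) (hγ : IsEigen γ c) :
    massForm (a + b + c) (a + b + c) = massForm a a + massForm b b + massForm c c ∧
    spinForm (a + b + c) (a + b + c) =
      α * massForm a a + β * massForm b b + γ * massForm c c := by
  have h1 := massForm_eigen_of_ne hαβ ha hb hα hβ
  have h2 := massForm_eigen_of_ne hαγ ha hc hα hγ
  have h3 := massForm_eigen_of_ne hβγ hb hc hβ hγ
  have h1' := (massForm_comm b a).trans h1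
  have h2' := (massForm_comm c a).trans h2
  have h3' := (massForm_comm c b).trans h3
  constructor
  · simp only [massForm_add_left, massForm_add_right, h1, h2, h3, h1', h2', h3']
    ring
  · simp only [spinForm_add_right, massForm_add_left, hα _, hβ _, hγ _, h1, h2, h3, h1', h2', h3']
    ring

/-- The negative coefficients are that of b at m = 0 and that of c at m = 0 and m = 1. The first and
last belong to H₃,₀ and are subtracted; the remaining one is absorbed by the penalty. The
coefficient of c vanishes at m = 2, the equality case. -/
lemma gapForm_eigen {m : ℕ} {a b c : W12} (ha : a ∈ Harm (m + 1)) (hb : b ∈ Harm (m + 1))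
    (hc : c ∈ Harm (m + 1)) (hα : IsEigen (-(m + 1)) a) (hβ : IsEigen 1 b)
    (hγ : IsEigen (m + 2) c) :
    gapForm (a + b + c) (a + b + c) =
      (m + 1) * (m + 5) / 2 * massForm a a + ((m + 1) * (m + 2) - 3) / 2 * massForm b b +
        (m + 2) * (m - 2) / 2 * massForm c c + 2 * massForm (a + b + c) position ^ 2 := by
  have hm := m.cast_nonneg (α := ℝ)
  obtain ⟨h1, h2⟩ := massForm_spinForm_of_eigen (by intro h; linarith) (by intro h; linarith)
    (by intro h; linarith) (Harm_le_range _ ha) (Harm_le_range _ hb) (Harm_le_range _ hc) hα hβ hγ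
  rw [gapForm, dirichletForm_Harm _ (add_mem (add_mem ha hb) hc), h1, h2]
  push_cast
  ring

lemma isEigen_zero (μ : ℝ) : IsEigen μ 0 := fun v => by
  rw [spinForm_zero_right, massForm_zero_right, mul_zero]

lemma isEigen_polyMap_one {p : Fin 3 → MvPolynomial (Fin 3) ℝ} (h : polyA p = p) :
    IsEigen 1 (polyMap p) := isEigen_polyMap (by rw [h, one_smul])

lemma gapForm_Harm_zero_nonneg {w : W12} (hw : w ∈ Harm 0) : 0 ≤ gapForm w w := by
  obtain ⟨p, hp, rfl⟩ := hw
  rw [gapForm, dirichletForm_polyMap _ hp, spinForm_polyMap, polyA_of_mem_harmFields_zero hp,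
    polyMap.map_zero, massForm_zero_right]
  push_cast
  nlinarith [mul_self_nonneg (massForm (polyMap p) position)]

lemma polyMap_mem_Hk2_one {b : Fin 3 → MvPolynomial (Fin 3) ℝ} (hb : b ∈ harmFields 1)
    (hdb : pdiv b = 0) (hAb : polyA b = b) : polyMap b ∈ Hk2 1 := by
  have hbx : massForm (polyMap b) position = 0 :=
    massForm_eigen_of_ne (by norm_num) ⟨_, rfl⟩ ⟨_, rfl⟩ (isEigen_polyMap_one hAb)
      isEigen_position
  refine ⟨mem_HkSol_iff.2 ⟨mem_H_of_Harm le_rfl (polyMap_mem_Harm hb) hbx, b, hb, hdb, rfl⟩, ?_⟩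
  have h := A_polyMap b
  rwa [hAb] at h

/-- Converse of `Hk3_spec`: a solenoidal field has no third component, so only eigenvalues -(m+2)
and 1 occur in it, and both differ from m+3. -/
lemma mem_Hk3_of_isEigen {m : ℕ} {w : W12} (hw : w ∈ Harm (m + 2)) (he : IsEigen (m + 3) w) :
    w ∈ Hk3 (m + 2) := by
  have hm := m.cast_nonneg (α := ℝ)
  refine ⟨mem_Hk_iff.2 ⟨mem_H_of_Harm_two_le (by omega) hw, hw⟩, ?_⟩
  refine (Submodule.mem_orthogonal' _ _).2 fun v hv => ?_
  obtain ⟨-, q, hq, hdq, rfl⟩ := mem_HkSol_iff.1 hv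
  rw [inner_eq_zero_iff_massForm _ (polyMap_mem_Harm hq)]
  obtain ⟨a, b, c, rfl, -, -, -, -, -, hAa, hAb, -, -, h0⟩ := exists_eigen_decomposition hq
  have h1 : massForm w (polyMap a) = 0 := massForm_eigen_of_ne (by push_cast; intro h; linarith)
    (Harm_le_range _ hw) ⟨_, rfl⟩ he (isEigen_polyMap hAa)
  have h2 : massForm w (polyMap b) = 0 := massForm_eigen_of_ne (by intro h; linarith)
    (Harm_le_range _ hw) ⟨_, rfl⟩ he (isEigen_polyMap_one hAb)
  rw [h0 hdq, add_zero, polyMap.map_add, massForm_add_right, h1, h2, add_zero]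

/-- The mode c contributes -2s², which the penalty 2s² cancels exactly; this fixes the factor 2 in
`gapForm`. -/
lemma gapForm_Harm_one_nonneg {a c : W12} {s : ℝ} (ha : a ∈ Harm 1) (hα : IsEigen (-1) a)
    (hc : c = s • position) : 0 ≤ gapForm (a + c) (a + c) := by
  have hcH : c ∈ Harm 1 := hc ▸ Submodule.smul_mem _ s position_mem_Harm
  have hγ : IsEigen 2 c := fun v => by
    rw [hc, spinForm_smul_right, massForm_smul_right, isEigen_position v]
    ring
  have hax : massForm a position = 0 := massForm_eigen_of_ne (by norm_num) (Harm_le_range _ ha)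
    (Harm_le_range _ position_mem_Harm) hα isEigen_position
  have h1 : massForm (a + c) position = s := by
    rw [massForm_add_left, hax, hc, massForm_smul_left, massForm_position_self, zero_add, mul_one]
  have h2 : massForm c c = s ^ 2 := by
    rw [hc, massForm_smul_left, massForm_smul_right, massForm_position_self]
    ring
  have h3 := gapForm_eigen (m := 0) (b := 0) ha (zero_mem _) hcH (by simpa using hα)
    (isEigen_zero 1) (by simpa using hγ)
  rw [add_zero, h1, h2, massForm_zero_left] at h3
  rw [h3]
  have h4 := massForm_self_nonneg a
  norm_num
  nlinarith

lemma gapForm_Harm_two_nonneg {a b : W12} (ha : a ∈ Harm 2) (hb : b ∈ Harm 2)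
    (hα : IsEigen (-2) a) (hβ : IsEigen 1 b) : 0 ≤ gapForm (a + b) (a + b) := by
  have h3 := gapForm_eigen (m := 1) (c := 0) ha hb (zero_mem _)
    (by convert hα using 1; norm_num) hβ (isEigen_zero _)
  rw [add_zero, massForm_zero_left] at h3
  rw [h3]
  have h4 := massForm_self_nonneg a
  have h5 := massForm_self_nonneg b
  have h6 := sq_nonneg (massForm (a + b) position)
  norm_num
  linarith

lemma gapForm_Harm_three_le_nonneg {m : ℕ} {a b c : W12} (ha : a ∈ Harm (m + 3))
    (hb : b ∈ Harm (m + 3)) (hc : c ∈ Harm (m + 3)) (hα : IsEigen (-(m + 3)) a)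
    (hβ : IsEigen 1 b) (hγ : IsEigen (m + 4) c) :
    0 ≤ gapForm (a + b + c) (a + b + c) := by
  have hm := m.cast_nonneg (α := ℝ)
  rw [gapForm_eigen (m := m + 2) ha hb hc (by convert hα using 1; push_cast; ring) hβ
    (by convert hγ using 1; push_cast; ring)]
  push_cast
  have h1 : (0 : ℝ) ≤ ((m : ℝ) + 2 + 1) * (m + 2 + 5) / 2 := by positivity
  have h2 : (0 : ℝ) ≤ (((m : ℝ) + 2 + 1) * (m + 2 + 2) - 3) / 2 := by nlinarith
  -- This is zero at m = 0, that is in degree three, so there is no slack here in the constant 1/4.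
  have h3 : (0 : ℝ) ≤ ((m : ℝ) + 2 + 2) * (m + 2 - 2) / 2 := by nlinarith
  have h4 := mul_nonneg h1 (massForm_self_nonneg a)
  have h5 := mul_nonneg h2 (massForm_self_nonneg b)
  have h6 := mul_nonneg h3 (massForm_self_nonneg c)
  have h7 := sq_nonneg (massForm (a + b + c) position)
  linarith

/-- Spherical harmonic maps are sums of eigenvectors of `A`. -/
lemma exists_eigen_decomposition_Harm {m : ℕ} {w : W12} (hw : w ∈ Harm (m + 1)) :
    ∃ a ∈ Harm (m + 1), ∃ b ∈ harmFields (m + 1), ∃ c ∈ Harm (m + 1), w = a + polyMap b + c ∧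
      IsEigen (-(m + 1)) a ∧ pdiv b = 0 ∧ polyA b = b ∧ IsEigen (m + 2) c ∧
      ∃ d, ∃ t : ℝ, IsHarm m d ∧ c = t • polyMap (radialHarm m d) := by
  obtain ⟨p, hp, rfl⟩ := hw
  obtain ⟨a, b, c, rfl, ha, hb, hc, -, hdb, hAa, hAb, hAc, ⟨d, t, hd, hct⟩, -⟩ :=
    exists_eigen_decomposition hp
  refine ⟨polyMap a, polyMap_mem_Harm ha, b, hb, polyMap c, polyMap_mem_Harm hc, ?_,
    isEigen_polyMap hAa, hdb, hAb, isEigen_polyMap hAc, d, t, hd, ?_⟩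
  · rw [polyMap.map_add, polyMap.map_add]
  · rw [hct, polyMap.map_smul]

lemma exists_gapForm_nonneg_Harm_one {w : W12} (hw : w ∈ Harm 1) :
    ∃ u ∈ H0, u ∈ Harm 1 ∧ 0 ≤ gapForm (w - u) (w - u) := by
  obtain ⟨a, ha, b, hb, c, hc, rfl, hα, hdb, hAb, hγ, d, t, hd, hct⟩ :=
    exists_eigen_decomposition_Harm (m := 0) hw
  refine ⟨polyMap b, Submodule.mem_sup_left (polyMap_mem_Hk2_one hb hdb hAb),
    polyMap_mem_Harm hb, ?_⟩
  obtain ⟨r, hr⟩ := radialHarm_zero hd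
  have hc' : c = (t * r) • position := by
    rw [hct, hr, polyMap.map_smul, smul_smul, position]
  have e : a + polyMap b + c - polyMap b = a + c := by
    rw [add_right_comm, add_sub_cancel_right]
  rw [e]
  exact gapForm_Harm_one_nonneg ha (by simpa using hα) hc'

lemma exists_gapForm_nonneg_Harm_two {w : W12} (hw : w ∈ Harm 2) :
    ∃ u ∈ H0, u ∈ Harm 2 ∧ 0 ≤ gapForm (w - u) (w - u) := by
  obtain ⟨a, ha, b, hb, c, hc, rfl, hα, hdb, hAb, hγ, -⟩ :=
    exists_eigen_decomposition_Harm (m := 1) hw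
  have hγ' : IsEigen ((0 : ℕ) + 3) c := by
    convert hγ using 1
    norm_num
  refine ⟨c, Submodule.mem_sup_right (mem_Hk3_of_isEigen (m := 0) hc hγ'), hc, ?_⟩
  rw [add_sub_cancel_right]
  exact gapForm_Harm_two_nonneg ha (polyMap_mem_Harm hb) (by convert hα using 1; norm_num)
    (isEigen_polyMap_one hAb)

/-- On each space of spherical harmonics the form `gapForm` is nonnegative modulo `H0`. -/
lemma exists_gapForm_nonneg_Harm (k : ℕ) {w : W12} (hw : w ∈ Harm k) :
    ∃ u ∈ H0, u ∈ Harm k ∧ 0 ≤ gapForm (w - u) (w - u) := by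
  match k, hw with
  | 0, hw => exact ⟨0, zero_mem _, zero_mem _, by rw [sub_zero]; exact gapForm_Harm_zero_nonneg hw⟩
  | 1, hw => exact exists_gapForm_nonneg_Harm_one hw
  | 2, hw => exact exists_gapForm_nonneg_Harm_two hw
  | m + 3, hw =>
    obtain ⟨a, ha, b, hb, c, hc, rfl, hα, -, hAb, hγ, -⟩ :=
      exists_eigen_decomposition_Harm (m := m + 2) hw
    refine ⟨0, zero_mem _, zero_mem _, ?_⟩
    rw [sub_zero]
    exact gapForm_Harm_three_le_nonneg ha (polyMap_mem_Harm hb) hc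
      (by convert hα using 1; push_cast; ring) (isEigen_polyMap_one hAb)
      (by convert hγ using 1; push_cast; ring)

lemma exists_gapForm_nonneg {w : W12} (hw : w ∈ ⨆ k, Harm k) :
    ∃ u ∈ H0, 0 ≤ gapForm (w - u) (w - u) := by
  obtain ⟨f, hf, rfl⟩ := (Submodule.mem_iSup_iff_exists_finsupp _ _).1 hw
  choose u hu hu' hpos using fun k => exists_gapForm_nonneg_Harm k (hf k)
  refine ⟨∑ k ∈ f.support, u k, Submodule.sum_mem _ fun k _ => hu k, ?_⟩
  rw [Finsupp.sum, ← Finset.sum_sub_distrib, gapForm_sum]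
  refine Finset.sum_nonneg fun k hk => ?_
  rw [Finset.sum_eq_single k (fun l _ hl => ?_) (fun h => absurd hk h)]
  · exact hpos k
  · exact gapForm_Harm_of_ne hl.symm (sub_mem (hf k) (hu' k)) (sub_mem (hf l) (hu' l))

/-! ### From single degrees to the coercivity estimate and the kernel. -/

lemma Q3bilin_self (w : W12) : Q3bilin w w = Q3 w := by
  rw [Q3_eq, Q3bilin_eq]

/-- `Q3bilin_H0` kills the terms with u in the second slot; symmetry of the spin form on polynomial
maps handles u in the first slot. -/
lemma Q3_sub_H0 {w u : W12} (hw : w ∈ LinearMap.range polyMap) (hu : u ∈ H0) :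
    Q3 (w - u) = Q3 w := by
  have h1 := Q3bilin_H0 w hu
  have h2 := Q3bilin_H0 u hu
  rw [Q3bilin_eq] at h1 h2
  have h3 := spinForm_comm (H0_le_range hu) hw
  have h4 := dirichletForm_comm u w
  simp only [Q3_eq, dirichletForm_sub_left, dirichletForm_sub_right, spinForm_sub_left,
    spinForm_sub_right]
  linarith

lemma gapForm_eq (w : W12) :
    gapForm w w = Q3 w - 1 / 4 * dirichletForm w w + 2 * massForm w position ^ 2 := by
  rw [gapForm, Q3_eq]
  ring

/-- Orthogonality to each summand holds separately, and each has a single degree, on which the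
Sobolev product and the Dirichlet form are both multiples of the mass. -/
lemma dirichletForm_eq_zero_of_orthogonal {z y : W12} (hz : z ∈ H0ᗮ) (hy : y ∈ H0) :
    dirichletForm z y = 0 := by
  obtain ⟨a, ha, b, hb, rfl⟩ := Submodule.mem_sup.1 hy
  have ha0 := (Submodule.mem_orthogonal' _ _).1 hz a (Submodule.mem_sup_left ha)
  have hb0 := (Submodule.mem_orthogonal' _ _).1 hz b (Submodule.mem_sup_right hb)
  have ha1 := (Hk2_spec ha).2.1
  have hb1 := (Hk3_spec (m := 0) hb).2.1
  rw [inner_eq_zero_iff_massForm _ ha1] at ha0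
  rw [inner_eq_zero_iff_massForm _ hb1] at hb0
  rw [dirichletForm_add_right, dirichletForm_Harm z ha1, dirichletForm_Harm z hb1, ha0, hb0]
  ring

/-- Pythagoras for the Dirichlet form. It allows any convenient u in H₃,₀ to stand in for the
projection in the estimate. -/
lemma dirichletForm_sub_starProjection_le (w : W12) {u : W12} (hu : u ∈ H0) :
    dirichletForm (w - H0.starProjection w) (w - H0.starProjection w) ≤
      dirichletForm (w - u) (w - u) := by
  set z := w - H0.starProjection w with hz
  set y := H0.starProjection w - u with hy
  have hyH : y ∈ H0 := sub_mem (H0.starProjection_apply_mem w) hu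
  have hzH : z ∈ H0ᗮ := H0.sub_starProjection_mem_orthogonal w
  have h0 := dirichletForm_eq_zero_of_orthogonal hzH hyH
  have h1 := (dirichletForm_comm y z).trans h0
  have e : w - u = z + y := by rw [hz, hy]; abel
  rw [e]
  simp only [dirichletForm_add_left, dirichletForm_add_right, h0, h1]
  linarith [dirichletForm_self_nonneg y]

lemma coercivity_of_mem_iSup {w : W12} (hw : w ∈ ⨆ k, Harm k) :
    1 / 4 * dirichletForm (w - H0.starProjection w) (w - H0.starProjection w) ≤
      Q3 w + 2 * massForm w position ^ 2 := by
  obtain ⟨u, hu, h⟩ := exists_gapForm_nonneg hw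
  have hr : (⨆ k, Harm k) ≤ LinearMap.range polyMap := iSup_le Harm_le_range
  have h1 : massForm u position = 0 := ((mem_H_iff u).1 (H0_le_H hu)).2
  rw [gapForm_eq, Q3_sub_H0 (hr hw) hu, massForm_sub_left, h1, sub_zero] at h
  linarith [dirichletForm_sub_starProjection_le w hu]

lemma continuous_Q3 : Continuous Q3 := by
  have h : Q3 = fun w => 3 / 4 * inner ℝ (gradLp w) (gradLp w) -
      3 / 2 * inner ℝ (valLp w) (ALp w) := by
    funext w
    rw [Q3_eq, dirichletForm_eq_inner, spinForm_eq_inner]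
  rw [h]
  have h1 := continuous_gradLp
  have h2 := continuous_valLp
  have h3 := continuous_ALp
  fun_prop

/-- The coercivity estimate on the whole Sobolev space. -/
lemma coercivity (w : W12) :
    1 / 4 * dirichletForm (w - H0.starProjection w) (w - H0.starProjection w) ≤
      Q3 w + 2 * massForm w position ^ 2 := by
  -- Both sides are continuous in the Sobolev norm, so the estimate passes to the closure of the
  -- finite sums of harmonics, which is everything.
  have hcl : IsClosed {w : W12 |
      1 / 4 * dirichletForm (w - H0.starProjection w) (w - H0.starProjection w) ≤
        Q3 w + 2 * massForm w position ^ 2} := by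
    have h1 : Continuous fun w : W12 => gradLp (w - H0.starProjection w) :=
      continuous_gradLp.comp (continuous_id.sub H0.starProjection.continuous)
    have h2 := continuous_valLp
    have h3 := continuous_Q3
    simp only [dirichletForm_eq_inner, massForm_eq_inner]
    exact isClosed_le (by fun_prop) (by fun_prop)
  have hw : w ∈ (⨆ k, Harm k).topologicalClosure := by
    rw [iSup_Harm_topologicalClosure]
    trivial
  exact closure_minimal (fun v hv => coercivity_of_mem_iSup hv) hcl hw

lemma coercivity_H {w : W12} (hw : w ∈ H) :
    1 / 4 * dirichletForm (w - H0.starProjection w) (w - H0.starProjection w) ≤ Q3 w := by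
  have h := coercivity w
  rw [((mem_H_iff w).1 hw).2] at h
  linarith

/-- A map in `H` with vanishing gradient vanishes. -/
lemma eq_zero_of_dirichletForm {w : W12} (hw : w ∈ H) (h : dirichletForm w w = 0) : w = 0 := by
  have h0 : gradLp w = 0 := inner_self_eq_zero.1 ((dirichletForm_eq_inner w w).symm.trans h)
  refine eq_zero_of_massForm_Harm fun k v hv => ?_
  rcases Nat.eq_zero_or_pos k with rfl | hk
  · exact ((mem_H_iff w).1 hw).1 v hv
  · have h1 := dirichletForm_Harm w hv
    rw [dirichletForm_eq_inner, h0, inner_zero_left] at h1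
    have h2 : (k * (k + 1) : ℝ) ≠ 0 := by positivity
    exact (mul_eq_zero.1 h1.symm).resolve_left h2

/-- Coercivity forces the gradient of w minus its projection to vanish, and this difference stays in
`H`, where only zero has zero gradient. -/
lemma mem_H0_of_Q3 {w : W12} (hw : w ∈ H) (h : Q3 w = 0) : w ∈ H0 := by
  have h1 := coercivity_H hw
  rw [h] at h1
  have h2 : dirichletForm (w - H0.starProjection w) (w - H0.starProjection w) = 0 :=
    le_antisymm (by linarith) (dirichletForm_self_nonneg _)
  have h3 := eq_zero_of_dirichletForm
    (sub_mem hw (H0_le_H (H0.starProjection_apply_mem w))) h2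
  rw [sub_eq_zero.1 h3]
  exact H0.starProjection_apply_mem w

lemma integral_norm_grad_sub (v w : W12) :
    ∫ x, ‖grad v x - grad w x‖ ^ 2 ∂σ = dirichletForm (v - w) (v - w) := by
  rw [dirichletForm_apply]
  have h : grad (v - w) =ᵐ[σ] grad v - grad w := Lp.coeFn_sub _ _
  refine integral_congr_ae ?_
  filter_upwards [h] with x hx
  rw [hx, real_inner_self_eq_norm_sq, Pi.sub_apply]

/-! ### Sharpness of the constant. -/

instance : σ.IsOpenPosMeasure := by
  have h : ((volume : Measure E3).toSphere Set.univ)⁻¹ ≠ 0 :=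
    ENNReal.inv_ne_zero.2 (measure_ne_top _ _)
  exact Measure.isOpenPosMeasure_smul _ h

lemma isHarm_X_mul_X : IsHarm 2 (X 0 * X 1) :=
  ⟨(MvPolynomial.isHomogeneous_X _ _).mul (MvPolynomial.isHomogeneous_X _ _), by
    rw [lap_X_mul, (isHarm_X 1).2, pderiv_X_ite]
    simp⟩

/-- A third order spherical harmonic field for which the coercivity estimate is an equality. -/
def extremal : W12 := polyMap (radialHarm 2 (X 0 * X 1))

lemma extremal_mem_Harm : extremal ∈ Harm 3 :=
  polyMap_mem_Harm fun j => isHarm_radialHarm isHarm_X_mul_X j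

lemma isEigen_extremal : IsEigen 4 extremal := by
  have h := polyA_radialHarm isHarm_X_mul_X
  refine isEigen_polyMap (h.trans ?_)
  norm_num

lemma extremal_ne_zero : extremal ≠ 0 := by
  intro h
  have h1 : (fun x : S2 => pfield (radialHarm 2 (X 0 * X 1)) x) =ᵐ[σ] fun _ => 0 := by
    refine (val_polyMap _).symm.trans ?_
    change val extremal =ᵐ[σ] 0
    rw [h]
    exact val_zero
  -- Continuity makes the almost everywhere identity pointwise. At (0, 1, 0) the first component of
  -- the field is -1/5.
  have h2 := (continuous_pfield_sphere _).ae_eq_iff_eq σ continuous_const |>.1 h1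
  have h3 := congrArg (fun v : E3 => v 0) (congrFun h2 ⟨EuclideanSpace.single 1 1, by simp⟩)
  simp only [pfield_apply, radialHarm, peval_sub, peval_smul, peval_mul, peval_X, pderiv_X_ite,
    MvPolynomial.pderiv_mul, peval_add, rsq, sq, Fin.sum_univ_three] at h3
  have h4 : (2 : Fin 3) ≠ 1 := by decide
  norm_num [peval_one, peval_zero, h4] at h3

lemma extremal_mem_H : extremal ∈ H := mem_H_of_Harm_two_le (by norm_num) extremal_mem_Harm

lemma starProjection_extremal : H0.starProjection extremal = 0 := by
  rw [Submodule.starProjection_apply_eq_zero_iff]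
  refine (Submodule.mem_orthogonal' _ _).2 fun u hu => ?_
  obtain ⟨a, ha, b, hb, rfl⟩ := Submodule.mem_sup.1 (H0_le_Harm hu)
  rw [inner_add_right, (inner_eq_zero_iff_massForm _ ha).2
      (massForm_Harm_of_ne (by norm_num) extremal_mem_Harm ha),
    (inner_eq_zero_iff_massForm _ hb).2
      (massForm_Harm_of_ne (by norm_num) extremal_mem_Harm hb), add_zero]

end SphereCoercivity

end

theorem theorem4 :
    SphereCoercivity.Hk2 1 ⟂ SphereCoercivity.Hk3 2 ∧
    (∀ w : SphereCoercivity.W12, w ∈ SphereCoercivity.H0 ↔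
      w ∈ SphereCoercivity.H ∧
        ∀ v ∈ SphereCoercivity.H, SphereCoercivity.Q3bilin v w = 0) ∧
    (∀ w : SphereCoercivity.W12, w ∈ SphereCoercivity.H0 ↔
      w ∈ SphereCoercivity.H ∧ SphereCoercivity.Q3 w = 0) ∧
    ∃ _ : SphereCoercivity.H0.HasOrthogonalProjection,
      (∀ w ∈ SphereCoercivity.H,
        SphereCoercivity.Q3 w ≥
          1 / 4 * ∫ x, ‖SphereCoercivity.grad w x -
            SphereCoercivity.grad (SphereCoercivity.H0.starProjection w) x‖ ^ 2
              ∂SphereCoercivity.σ) ∧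
      ∀ C : ℝ,
        (∀ w ∈ SphereCoercivity.H,
          SphereCoercivity.Q3 w ≥
            C * ∫ x, ‖SphereCoercivity.grad w x -
              SphereCoercivity.grad (SphereCoercivity.H0.starProjection w) x‖ ^ 2
                ∂SphereCoercivity.σ) →
        C ≤ 1 / 4 := by
  refine ⟨SphereCoercivity.Hk2_one_isOrtho_Hk3_two,
    fun w => ⟨fun h => ⟨SphereCoercivity.H0_le_H h, fun v _ => SphereCoercivity.Q3bilin_H0 v h⟩,
      fun h => SphereCoercivity.mem_H0_of_Q3 h.1
        ((SphereCoercivity.Q3bilin_self w).symm.trans (h.2 w h.1))⟩,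
    fun w => ⟨fun h => ⟨SphereCoercivity.H0_le_H h,
        (SphereCoercivity.Q3bilin_self w).symm.trans (SphereCoercivity.Q3bilin_H0 w h)⟩,
      fun h => SphereCoercivity.mem_H0_of_Q3 h.1 h.2⟩, inferInstance, fun w hw => ?_, fun C hC => ?_⟩
  · rw [SphereCoercivity.integral_norm_grad_sub]
    exact SphereCoercivity.coercivity_H hw
  -- With degree 3, eigenvalue 4 and zero projection, the hypothesis reads 3/4·12 - 3/2·4 = 3 ≥ 12 C
  -- after division by the positive mass.
  · have h := hC _ SphereCoercivity.extremal_mem_H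
    rw [SphereCoercivity.integral_norm_grad_sub, SphereCoercivity.starProjection_extremal, sub_zero,
      SphereCoercivity.Q3_eq, SphereCoercivity.isEigen_extremal,
      SphereCoercivity.dirichletForm_Harm _ SphereCoercivity.extremal_mem_Harm] at h
    have h0 : 0 < SphereCoercivity.massForm SphereCoercivity.extremal SphereCoercivity.extremal :=
      lt_of_le_of_ne (SphereCoercivity.massForm_self_nonneg _) fun h0 =>
        SphereCoercivity.extremal_ne_zero (SphereCoercivity.eq_zero_of_massForm_self h0.symm)
    push_cast at h
    by_contra! hlt
    nlinarith
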